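/- Conventions. All structures are finite with nonempty universe, and every vocabulary is a finite set of unary and binary relation symbols (drawn from fixed countable supplies of unary and of binary symbols). $\mathrm{MSO}(\mathcal C)$ denotes monadic second order logic over $\mathcal C$ whose second order quantifiers range over subsets of the universe and over subsets of the relations of the structure; $C^2(\mathcal C)$ denotes the two-variable fragment of first order logic over $\mathcal C$ extended with the counting quantifiers $\exists^{\le n},\exists^{\ge n},\exists^{=n}$ ($n\in\mathbb N$). For a structure $\mathfrak M$ over a vocabulary containing $\mathcal C$, $\mathfrak M|_{\mathcal C}$ is its reduct to $\mathcal C$. The tree-width $\mathrm{tw}(\mathfrak A)$ of a structure is the tree-width of its Gaifman graph, in which two distinct elements are adjacent iff they are related, in some order, by some binary relation of $\mathfrak A$. A binary relation on a set is a binary tree if it is an acyclic directed graph in which exactly one vertex (the root) has in-degree $0$, every other vertex has in-degree $1$, and every vertex has out-degree at most $2$. Lemma. Let $k\in\mathbb N$. Let $\mathcal C_{\mathrm{bd}}$ and $\mathcal C_{\mathrm{unbd}}$ be vocabularies such that $\mathcal C_{\mathrm{bd}}\cap\mathcal C_{\mathrm{unbd}}$ contains only unary relation symbols, and let $s$ be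 a binary relation symbol with $s\notin\mathcal C_{\mathrm{unbd}}$. There is a vocabulary $\mathcal D_{\mathrm{bd}}$, consisting of $s$ and unary relation symbols only, such that for all sentences $\alpha\in\mathrm{MSO}(\mathcal C_{\mathrm{bd}})$ and $\beta\in C^2(\mathcal C_{\mathrm{unbd}})$ there are effectively computable sentences $\alpha'\in\mathrm{MSO}(\mathcal D_{\mathrm{bd}})$ and $\beta'\in C^2(\mathcal D_{\mathrm{bd}}\cup\mathcal C_{\mathrm{unbd}})$ for which the following are equivalent: (i) there is a $(\mathcal C_{\mathrm{bd}}\cup\mathcal C_{\mathrm{unbd}})$-structure $\mathfrak M$ such that $\mathfrak M\models\alpha\wedge\beta$ and $\mathrm{tw}(\mathfrak M|_{\mathcal C_{\mathrm{bd}}})\le k$; (ii) there is a $(\mathcal D_{\mathrm{bd}}\cup\mathcal C_{\mathrm{unbd}})$-structure $\mathfrak N$ such that $\mathfrak N\models\alpha'\wedge\beta'$ and $s^{\mathfrak N}$ is a binary tree. Here "effectively computable" means that, for each $k$, there are two algorithms: one computes $\alpha'$ from $\mathcal C_{\mathrm{bd}},\mathcal C_{\mathrm{unbd}},s,\alpha$,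 and the other computes $\beta'$ from $\mathcal C_{\mathrm{bd}},\mathcal C_{\mathrm{unbd}},s,\beta$. -/

import Mathlib

/-- A vocabulary: a finite set of unary and a finite set of binary relation symbols, both drawn from
countable supplies indexed by `ℕ`. A unary and a binary symbol are never the same symbol. -/
structure Vocab where
  un : Finset ℕ
  bin : Finset ℕ

namespace Vocab

instance : Union Vocab := ⟨fun C D => ⟨C.un ∪ D.un, C.bin ∪ D.bin⟩⟩

instance : HasSubset Vocab := ⟨fun C D => C.un ⊆ D.un ∧ C.bin ⊆ D.bin⟩

theorem subset_union_left (C D : Vocab) : C ⊆ C ∪ D :=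
  ⟨Finset.subset_union_left, Finset.subset_union_left⟩

theorem subset_union_right (C D : Vocab) : D ⊆ C ∪ D :=
  ⟨Finset.subset_union_right, Finset.subset_union_right⟩

/-- A number coding a vocabulary, so that it can be an input of an algorithm. -/
def code (C : Vocab) : ℕ :=
  Nat.pair (Encodable.encode (C.un.sort (· ≤ ·))) (Encodable.encode (C.bin.sort (· ≤ ·)))

/-- Distinct vocabularies have distinct codes. -/
theorem code_inj (C D : Vocab) (h : C.code = D.code) : C = D := by
  obtain ⟨a, b⟩ := C
  obtain ⟨c, d⟩ := D
  simp only [Vocab.code, Nat.pair_eq_pair, Encodable.encode_inj] at h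
  have h1 := congrArg List.toFinset h.1
  have h2 := congrArg List.toFinset h.2
  simp at h1 h2
  simp [h1, h2]

end Vocab

/-- `C`-structures with universe `A`. -/
structure Struc (C : Vocab) (A : Type) where
  un : C.un → A → Prop
  bin : C.bin → A → A → Prop

/-- The reduct of a `D`-structure to a smaller vocabulary `C`. -/
def Struc.reduct {C D : Vocab} {A : Type} (M : Struc D A) (h : C ⊆ D) : Struc C A where
  un U := M.un ⟨U.1, h.1 U.2⟩
  bin B := M.bin ⟨B.1, h.2 B.2⟩

/-- The Gaifman graph: distinct elements are adjacent iff some binary relation relates them, in one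
of the two directions. -/
def Struc.gaifman {C : Vocab} {A : Type} (M : Struc C A) : SimpleGraph A where
  Adj a b := a ≠ b ∧ ∃ B : C.bin, M.bin B a b ∨ M.bin B b a
  symm := ⟨fun _ _ h => ⟨h.1.symm, h.2.imp fun _ => Or.symm⟩⟩
  loopless := ⟨fun _ h => h.1 rfl⟩

/-- `G` has tree-width at most `k`: there are a finite tree `T` and a bag of at most `k + 1` vertices
of `G` at every node of `T`, such that every edge of `G` lies in some bag and, for every vertex `v`,
the nodes whose bags contain `v` form a nonempty connected subtree. -/
def TreeWidthLE {V : Type} (G : SimpleGraph V) (k : ℕ) : Prop :=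
  ∃ (I : Type) (_ : Finite I) (T : SimpleGraph I) (bag : I → Finset V),
    T.IsTree ∧
    (∀ i, (bag i).card ≤ k + 1) ∧
    (∀ u v, G.Adj u v → ∃ i, u ∈ bag i ∧ v ∈ bag i) ∧
    (∀ v, (T.induce {i | v ∈ bag i}).Connected)

/-- The binary relation `r` (read `r x y` as: `y` is a child of `x`) is a binary tree on the whole
universe: a directed tree in which every vertex has at most two children. -/
def IsBinaryTree {A : Type} (r : A → A → Prop) : Prop :=
  (∀ x, ¬ Relation.TransGen r x x) ∧
  (∃ root, (∀ x, ¬ r x root) ∧ ∀ y, y ≠ root → ∃! x, r x y) ∧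
  (∀ x, {y | r x y}.encard ≤ 2)

/-- Variables of monadic second order logic: for elements, for sets of elements, and for subsets of
binary relations of the structure. -/
inductive MSOVar where
  | elem (n : ℕ)
  | set (n : ℕ)
  | rel (n : ℕ)

/-- Formulas of monadic second order logic over `C`, where second order quantifiers range over
subsets of the universe and over subsets of the relations of the structure. (Quantification over
subsets of a unary relation is definable from quantification over subsets of the universe.) -/
inductive MSO (C : Vocab) where
  | eq (x y : ℕ)
  | unary (U : C.un) (x : ℕ)
  | binary (B : C.bin) (x y : ℕ)
  | memSet (X x : ℕ)
  | memRel (P x y : ℕ)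
  | neg (φ : MSO C)
  | and (φ ψ : MSO C)
  /-- `∃ x, φ` -/
  | exElem (x : ℕ) (φ : MSO C)
  /-- `∃ X ⊆ universe, φ` -/
  | exSet (X : ℕ) (φ : MSO C)
  /-- `∃ P ⊆ B, φ` -/
  | exRel (P : ℕ) (B : C.bin) (φ : MSO C)

namespace MSO

variable {C : Vocab} {A : Type}

/-- Free variables. -/
def free : MSO C → Set MSOVar
  | eq x y => {.elem x, .elem y}
  | unary _ x => {.elem x}
  | binary _ x y => {.elem x, .elem y}
  | memSet X x => {.set X, .elem x}
  | memRel P x y => {.rel P, .elem x, .elem y}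
  | neg φ => free φ
  | and φ ψ => free φ ∪ free ψ
  | exElem x φ => free φ \ {.elem x}
  | exSet X φ => free φ \ {.set X}
  | exRel P _ φ => free φ \ {.rel P}

def IsSentence (φ : MSO C) : Prop := φ.free = ∅

/-- Satisfaction under assignments of the element, set and relation variables. -/
def Sat (M : Struc C A) : MSO C → (ℕ → A) → (ℕ → A → Prop) → (ℕ → A → A → Prop) → Prop
  | eq x y, e, _, _ => e x = e y
  | unary U x, e, _, _ => M.un U (e x)
  | binary B x y, e, _, _ => M.bin B (e x) (e y)
  | memSet X x, e, S, _ => S X (e x)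
  | memRel P x y, e, _, R => R P (e x) (e y)
  | neg φ, e, S, R => ¬ Sat M φ e S R
  | and φ ψ, e, S, R => Sat M φ e S R ∧ Sat M ψ e S R
  | exElem x φ, e, S, R => ∃ a : A, Sat M φ (Function.update e x a) S R
  | exSet X φ, e, S, R => ∃ Y : A → Prop, Sat M φ e (Function.update S X Y) R
  | exRel P B φ, e, S, R =>
      ∃ Q : A → A → Prop, (∀ a b, Q a b → M.bin B a b) ∧ Sat M φ e S (Function.update R P Q)

/-- `M ⊨ φ`, for sentences `φ`. -/
def Models (M : Struc C A) (φ : MSO C) : Prop := ∀ e S R, Sat M φ e S R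

/-- Gödel number of a formula. -/
def code : MSO C → ℕ
  | eq x y => Nat.pair 0 (Nat.pair x y)
  | unary U x => Nat.pair 1 (Nat.pair U.1 x)
  | binary B x y => Nat.pair 2 (Nat.pair B.1 (Nat.pair x y))
  | memSet X x => Nat.pair 3 (Nat.pair X x)
  | memRel P x y => Nat.pair 4 (Nat.pair P (Nat.pair x y))
  | neg φ => Nat.pair 5 φ.code
  | and φ ψ => Nat.pair 6 (Nat.pair φ.code ψ.code)
  | exElem x φ => Nat.pair 7 (Nat.pair x φ.code)
  | exSet X φ => Nat.pair 8 (Nat.pair X φ.code)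
  | exRel P B φ => Nat.pair 9 (Nat.pair P (Nat.pair B.1 φ.code))

/-- Distinct formulas have distinct Gödel numbers. -/
theorem code_inj : ∀ φ ψ : MSO C, φ.code = ψ.code → φ = ψ := by
  intro φ
  induction φ <;> intro ψ h <;> cases ψ <;>
    simp only [MSO.code, Nat.pair_eq_pair] at h <;> grind

end MSO

/-- Formulas of the two-variable fragment of first order logic with counting quantifiers over `C`.
The two variables are the elements of `Fin 2`. -/
inductive C2 (C : Vocab) where
  | eq (x y : Fin 2)
  | unary (U : C.un) (x : Fin 2)
  | binary (B : C.bin) (x y : Fin 2)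
  | neg (φ : C2 C)
  | and (φ ψ : C2 C)
  /-- `∃ x, φ` -/
  | ex (x : Fin 2) (φ : C2 C)
  /-- `∃^{≤ n} x, φ` -/
  | exLE (n : ℕ) (x : Fin 2) (φ : C2 C)
  /-- `∃^{≥ n} x, φ` -/
  | exGE (n : ℕ) (x : Fin 2) (φ : C2 C)
  /-- `∃^{= n} x, φ` -/
  | exEQ (n : ℕ) (x : Fin 2) (φ : C2 C)

namespace C2

variable {C : Vocab} {A : Type}

/-- Free variables. -/
def free : C2 C → Set (Fin 2)
  | eq x y => {x, y}
  | unary _ x => {x}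
  | binary _ x y => {x, y}
  | neg φ => free φ
  | and φ ψ => free φ ∪ free ψ
  | ex x φ => free φ \ {x}
  | exLE _ x φ => free φ \ {x}
  | exGE _ x φ => free φ \ {x}
  | exEQ _ x φ => free φ \ {x}

def IsSentence (φ : C2 C) : Prop := φ.free = ∅

/-- Satisfaction under an assignment of the two variables. -/
def Sat (M : Struc C A) : C2 C → (Fin 2 → A) → Prop
  | eq x y, e => e x = e y
  | unary U x, e => M.un U (e x)
  | binary B x y, e => M.bin B (e x) (e y)
  | neg φ, e => ¬ Sat M φ e
  | and φ ψ, e => Sat M φ e ∧ Sat M ψ e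
  | ex x φ, e => ∃ a : A, Sat M φ (Function.update e x a)
  | exLE n x φ, e => {a : A | Sat M φ (Function.update e x a)}.encard ≤ n
  | exGE n x φ, e => n ≤ {a : A | Sat M φ (Function.update e x a)}.encard
  | exEQ n x φ, e => {a : A | Sat M φ (Function.update e x a)}.encard = n

/-- `M ⊨ φ`, for sentences `φ`. -/
def Models (M : Struc C A) (φ : C2 C) : Prop := ∀ e, Sat M φ e

/-- Gödel number of a formula. -/
def code : C2 C → ℕ
  | eq x y => Nat.pair 0 (Nat.pair x y)
  | unary U x => Nat.pair 1 (Nat.pair U.1 x)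
  | binary B x y => Nat.pair 2 (Nat.pair B.1 (Nat.pair x y))
  | neg φ => Nat.pair 3 φ.code
  | and φ ψ => Nat.pair 4 (Nat.pair φ.code ψ.code)
  | ex x φ => Nat.pair 5 (Nat.pair x φ.code)
  | exLE n x φ => Nat.pair 6 (Nat.pair n (Nat.pair x φ.code))
  | exGE n x φ => Nat.pair 7 (Nat.pair n (Nat.pair x φ.code))
  | exEQ n x φ => Nat.pair 8 (Nat.pair n (Nat.pair x φ.code))

/-- Distinct formulas have distinct Gödel numbers. -/
theorem code_inj : ∀ φ ψ : C2 C, φ.code = ψ.code → φ = ψ := by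
  intro φ
  induction φ <;> intro ψ h <;> cases ψ <;>
    simp only [C2.code, Nat.pair_eq_pair] at h <;> grind

end C2

/-- The vocabulary consisting of the binary symbol `s` and the unary symbols in `W`. -/
def treeVocab (s : ℕ) (W : Finset ℕ) : Vocab := ⟨W, {s}⟩

/-- The interpretation of the symbol `s` in a structure over `treeVocab s W`. -/
def Struc.treeRel {s : ℕ} {W : Finset ℕ} {A : Type} (M : Struc (treeVocab s W) A) : A → A → Prop :=
  M.bin ⟨s, Finset.mem_singleton_self s⟩

/-! Everything rests on a description of tree-width inside the universe itself. A finite graph has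
tree-width at most `k` exactly when its vertices carry a forest order and a colouring with `k + 1`
colours such that every edge joins a vertex to its nearest ancestor of some colour
(`TreeWidthLE.exists_forest`, `IsForestOrder.treeWidthLE`). No bag nodes have to be added, so both
sides of the equivalence can share one universe, and the two-variable sentence can be kept as it is.

In one direction, vertices are ranked by the depth of the top of their subtree in a tree
decomposition. This gives a chordal completion with at most `k` earlier neighbours per vertex, which
is coloured greedily; the transitive closure of its edges is the forest order. In the other
direction, the bag at a vertex consists of its nearest ancestors of each colour.

A forest order is coded by a binary tree through first child and next sibling
(`IsForestOrder.exists_binaryTree`). Since a vertex has at most one nearest ancestor of each colour,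
a relation along such edges is determined by two unary labels per colour, one for each direction.
Every subrelation is coded in the same way (`Decode.of_subrelation`), so quantifiers over subsets of
relations become quantifiers over sets.

Hence `α'` guesses left children, colours and labels by set quantifiers and evaluates `α` in the
decoded structure (`MSO.sat_translate`), while `β'` is `β` over the larger vocabulary. The only
unary symbols needed are those of the bounded vocabulary, which keep their meaning. Effectiveness is
a primitive recursion on Gödel numbers. -/

/-! ### Forest orders -/

/-- A partial order in which the elements below a given one form a chain. -/
structure IsForestOrder {A : Type} (le : A → A → Prop) : Prop where
  refl : ∀ x, le x x
  trans : ∀ {x y z}, le x y → le y z → le x z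
  antisymm : ∀ {x y}, le x y → le y x → x = y
  chain : ∀ {x y z}, le x z → le y z → le x y ∨ le y x

/-- `x` is the nearest ancestor of `y` (possibly `y` itself) with the property `P`. -/
def Nearest {A : Type} (le : A → A → Prop) (P : A → Prop) (x y : A) : Prop :=
  le x y ∧ P x ∧ ∀ w, le x w → le w y → P w → w = x

/-- The ancestor relation coded by a binary tree `r` and the set `L` of its left children: going to
the left child is going to the first child, going to the right child is going to the next
sibling. -/
def Ancestor {A : Type} (r : A → A → Prop) (L : A → Prop) (x y : A) : Prop :=
  x = y ∨ ∃ z, r x z ∧ L z ∧ Relation.ReflTransGen r z y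

section forest

variable {A : Type} {le : A → A → Prop}

theorem Nearest.unique (h : IsForestOrder le) {P : A → Prop} {x x' y : A}
    (hx : Nearest le P x y) (hx' : Nearest le P x' y) : x = x' := by
  rcases h.chain hx.1 hx'.1 with h1 | h1
  · exact (hx.2.2 _ h1 hx'.1 hx'.2.1).symm
  · exact hx'.2.2 _ h1 hx.1 hx.2.1

theorem Nearest.self (h : IsForestOrder le) {P : A → Prop} {x : A} (hx : P x) :
    Nearest le P x x :=
  ⟨h.refl x, hx, fun _ h1 h2 _ => h.antisymm h2 h1⟩

theorem IsBinaryTree.parent_unique {r : A → A → Prop} (hr : IsBinaryTree r) {x x' y : A}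
    (h : r x y) (h' : r x' y) : x = x' := by
  obtain ⟨-, ⟨root, h1, h2⟩, -⟩ := hr
  have : y ≠ root := by rintro rfl; exact h1 _ h
  exact (h2 y this).unique h h'

theorem IsBinaryTree.reach_comparable {r : A → A → Prop} (hr : IsBinaryTree r) {x x' y : A}
    (h : Relation.ReflTransGen r x y) (h' : Relation.ReflTransGen r x' y) :
    Relation.ReflTransGen r x x' ∨ Relation.ReflTransGen r x' x := by
  induction h with
  | refl => exact .inr h'
  | tail hb hbc ih =>
    rcases h'.cases_tail with rfl | ⟨d, hd, hdc⟩
    · exact .inl (hb.tail hbc)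
    · obtain rfl := hr.parent_unique hbc hdc
      exact ih hd

theorem Ancestor.reach {r : A → A → Prop} {L : A → Prop} {x y : A} (h : Ancestor r L x y) :
    Relation.ReflTransGen r x y := by
  rcases h with rfl | ⟨z, h1, -, h2⟩
  · exact .refl
  · exact .head h1 h2

/-- Two left children that reach the same vertex are comparable, and parents are unique, so their
parents are comparable as ancestors. The set `L` is arbitrary, so a sentence that guesses `L` need
not constrain it. -/
theorem IsBinaryTree.isForestOrder_ancestor {r : A → A → Prop} (hr : IsBinaryTree r)
    (L : A → Prop) : IsForestOrder (Ancestor r L) where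
  refl x := .inl rfl
  trans := by
    rintro x y z (rfl | ⟨a, h1, h2, h3⟩) h'
    · exact h'
    · exact .inr ⟨a, h1, h2, h3.trans h'.reach⟩
  antisymm := by
    rintro x y (rfl | ⟨a, h1, h2, h3⟩) h'
    · rfl
    · exact absurd (Relation.TransGen.head' h1 (h3.trans h'.reach)) (hr.1 x)
  chain := by
    rintro x y z (rfl | ⟨a, h1, h2, h3⟩) hy
    · exact .inr hy
    rcases hy with rfl | ⟨b, h1', h2', h3'⟩
    · exact .inl (.inr ⟨a, h1, h2, h3⟩)
    rcases hr.reach_comparable h3 h3' with h4 | h4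
    · rcases h4.cases_tail with rfl | ⟨d, hd, hdc⟩
      · exact .inl (.inl (hr.parent_unique h1 h1'))
      · obtain rfl := hr.parent_unique hdc h1'
        exact .inl (.inr ⟨a, h1, h2, hd⟩)
    · rcases h4.cases_tail with rfl | ⟨d, hd, hdc⟩
      · exact .inl (.inl (hr.parent_unique h1 h1'))
      · obtain rfl := hr.parent_unique hdc h1
        exact .inr (.inr ⟨b, h1', h2', hd⟩)

/-- The number of ancestors grows strictly along the order. Multiplying it by `n` and adding an
index below `n` breaks ties without disturbing this. -/
theorem IsForestOrder.exists_rank [Finite A] (h : IsForestOrder le) :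
    ∃ ρ : A → ℕ, Function.Injective ρ ∧ ∀ x y, le x y → x ≠ y → ρ x < ρ y := by
  classical
  obtain ⟨n, ⟨e⟩⟩ := Finite.exists_equiv_fin A
  have hmono : ∀ x y, le x y → x ≠ y → {w | le w x}.ncard < {w | le w y}.ncard := by
    intro x y hxy hne
    apply Set.ncard_lt_ncard _ (Set.toFinite _)
    refine ⟨fun w hw => h.trans hw hxy, fun hsub => hne (h.antisymm hxy (hsub (h.refl y)))⟩
  refine ⟨fun x => n * {w | le w x}.ncard + e x, fun x y hxy => ?_, fun x y hxy hne => ?_⟩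
  · have h1 := congrArg (· % n) hxy
    simp [Nat.mod_eq_of_lt (e x).2, Nat.mod_eq_of_lt (e y).2] at h1
    exact e.injective (Fin.ext h1)
  · have h1 := hmono x y hxy hne
    have h2 := (e x).2
    have h3 : n * ({w | le w x}.ncard + 1) ≤ n * {w | le w y}.ncard := Nat.mul_le_mul_left n h1
    simp only [Nat.mul_add, Nat.mul_one] at h3
    simp only
    omega

/-- On a finite type, a nonempty set has an element of greatest rank. -/
theorem exists_max_rank [Finite A] (ρ : A → ℕ) (P : A → Prop) (h : ∃ x, P x) :
    ∃ x, P x ∧ ∀ y, P y → ρ y ≤ ρ x := by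
  obtain ⟨x, hx, hm⟩ := Set.exists_max_image {x | P x} ρ (Set.toFinite _) h
  exact ⟨x, hx, hm⟩

/-- On a finite type, a nonempty set has an element of least rank. -/
theorem exists_min_rank [Finite A] (ρ : A → ℕ) (P : A → Prop) (h : ∃ x, P x) :
    ∃ x, P x ∧ ∀ y, P y → ρ x ≤ ρ y := by
  obtain ⟨x, hx, hm⟩ := Set.exists_min_image {x | P x} ρ (Set.toFinite _) h
  exact ⟨x, hx, hm⟩

theorem IsForestOrder.exists_parent [Finite A] (h : IsForestOrder le) {x y : A} (hxy : le x y)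
    (hne : x ≠ y) : ∃ p, (le p y ∧ p ≠ y) ∧ ∀ w, le w y → w ≠ y → le w p := by
  obtain ⟨ρ, hinj, hρ⟩ := h.exists_rank
  obtain ⟨p, hp, hmax⟩ := exists_max_rank ρ (fun p => le p y ∧ p ≠ y) ⟨x, hxy, hne⟩
  refine ⟨p, hp, fun w hw hwy => ?_⟩
  rcases h.chain hw hp.1 with h1 | h1
  · exact h1
  · by_cases h2 : p = w
    · exact h2 ▸ h.refl p
    · exact absurd (hmax w ⟨hw, hwy⟩) (not_le.2 (hρ _ _ h1 h2))

/-- First-child/next-sibling coding: every forest order on a finite nonempty set is the ancestor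
relation coded by a binary tree. -/
theorem IsForestOrder.exists_binaryTree [Finite A] [Nonempty A] (h : IsForestOrder le) :
    ∃ (r : A → A → Prop) (L : A → Prop), IsBinaryTree r ∧ ∀ x y, Ancestor r L x y ↔ le x y := by
  obtain ⟨ρ, hinj, hρ⟩ := h.exists_rank
  let lt : A → A → Prop := fun x y => le x y ∧ x ≠ y
  let Par : A → A → Prop := fun x y => lt x y ∧ ∀ w, lt w y → le w x
  -- Siblings have the same strict ancestors. All roots of the forest are therefore siblings of each
  -- other and form one chain, which makes `r` a single tree.
  let Sib : A → A → Prop := fun x y => ∀ z, lt z x ↔ lt z y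
  let L : A → Prop := fun y => ∀ x, Sib x y → ρ y ≤ ρ x
  let Prev : A → A → Prop := fun x y =>
    Sib x y ∧ ρ x < ρ y ∧ ∀ z, Sib z y → ρ z < ρ y → ρ z ≤ ρ x
  let r : A → A → Prop := fun x y => (Par x y ∧ L y) ∨ Prev x y
  have ltρ : ∀ {x y}, lt x y → ρ x < ρ y := fun hxy => hρ _ _ hxy.1 hxy.2
  have lt_trans : ∀ {x y z}, lt x y → le y z → lt x z := fun {x y z} h1 h2 =>
    ⟨h.trans h1.1 h2, fun he => h1.2 (h.antisymm h1.1 (he ▸ h2))⟩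
  have rρ : ∀ {x y}, r x y → ρ x < ρ y := by
    rintro x y (h1 | h1)
    · exact ltρ h1.1.1
    · exact h1.2.1
  have hreach : ∀ {x y}, Relation.TransGen r x y → ρ x < ρ y := by
    intro x y hxy
    induction hxy with
    | single h1 => exact rρ h1
    | tail _ h1 ih => exact ih.trans (rρ h1)
  have hprev : ∀ y, ¬ L y → ∃ x, Prev x y := by
    intro y hy
    simp only [L, not_forall, not_le] at hy
    obtain ⟨x, hx, hxy⟩ := hy
    obtain ⟨p, hp, hm⟩ := exists_max_rank ρ (fun x => Sib x y ∧ ρ x < ρ y) ⟨x, hx, hxy⟩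
    exact ⟨p, hp.1, hp.2, fun z h1 h2 => hm z ⟨h1, h2⟩⟩
  have hLP : ∀ {x y}, L y → ¬ Prev x y := fun hL hP => absurd (hL _ hP.1) (not_le.2 hP.2.1)
  refine ⟨r, L, ⟨fun x hx => (hreach hx).false, ?_, ?_⟩, fun x y => ⟨?_, ?_⟩⟩
  · obtain ⟨root, -, hroot⟩ := exists_min_rank ρ (fun _ : A => True) ⟨Classical.arbitrary A, trivial⟩
    have hroot' : ∀ y, ρ root ≤ ρ y := fun y => hroot y trivial
    refine ⟨root, fun x hx => absurd (rρ hx) (not_lt.2 (hroot' x)), fun y hy => ?_⟩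
    by_cases hL : L y
    · have : ∃ x, lt x y := by
        by_contra hno
        push Not at hno
        have h1 := hL root fun z =>
          ⟨fun hz => absurd (ltρ hz) (not_lt.2 (hroot' z)), fun hz => absurd hz (hno z)⟩
        exact hy (hinj (le_antisymm h1 (hroot' y)))
      obtain ⟨x, hx⟩ := this
      obtain ⟨p, hp, hpm⟩ := h.exists_parent hx.1 hx.2
      refine ⟨p, .inl ⟨⟨hp, fun w hw => hpm w hw.1 hw.2⟩, hL⟩, ?_⟩
      rintro q (⟨hq, -⟩ | hq)
      · exact h.antisymm (hpm q hq.1.1 hq.1.2) (hq.2 p hp)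
      · exact absurd hq (hLP hL)
    · obtain ⟨p, hp⟩ := hprev y hL
      refine ⟨p, .inr hp, ?_⟩
      rintro q (⟨-, hq⟩ | hq)
      · exact absurd hq hL
      · exact hinj (le_antisymm (hp.2.2 q hq.1 hq.2.1) (hq.2.2 p hp.1 hp.2.1))
  · intro x
    have h1 : {y | r x y} ⊆ {y | Par x y ∧ L y} ∪ {y | Prev x y} := fun y hy => hy
    refine (Set.encard_le_encard h1).trans ((Set.encard_union_le _ _).trans ?_)
    rw [show (2 : ℕ∞) = 1 + 1 from rfl]
    have sib_of_par : ∀ {y z}, Par x y → Par x z → Sib y z := by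
      intro y z hy hz w
      exact ⟨fun hw => ⟨h.trans (hy.2 w hw) hz.1.1, fun he =>
          hz.1.2 (h.antisymm hz.1.1 (he ▸ hy.2 w hw))⟩,
        fun hw => ⟨h.trans (hz.2 w hw) hy.1.1, fun he =>
          hy.1.2 (h.antisymm hy.1.1 (he ▸ hz.2 w hw))⟩⟩
    gcongr
    · rw [Set.encard_le_one_iff]
      rintro a b ⟨ha, hLa⟩ ⟨hb, hLb⟩
      exact hinj (le_antisymm (hLa b (sib_of_par hb ha)) (hLb a (sib_of_par ha hb)))
    · rw [Set.encard_le_one_iff]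
      intro a b ha hb
      have hab : Sib a b := fun z => (ha.1 z).symm.trans (hb.1 z)
      have hba : Sib b a := fun z => (hab z).symm
      rcases lt_trichotomy (ρ a) (ρ b) with h2 | h2 | h2
      · exact absurd (hb.2.2 a hab h2) (not_le.2 ha.2.1)
      · exact hinj h2
      · exact absurd (ha.2.2 b hba h2) (not_le.2 hb.2.1)
  · rintro (rfl | ⟨z, h1, h2, h3⟩)
    · exact h.refl x
    · suffices lt x y from this.1
      induction h3 with
      | refl =>
        rcases h1 with h1 | h1
        · exact h1.1.1
        · exact absurd h1 (hLP h2)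
      | tail _ h4 ih =>
        rcases h4 with h4 | h4
        · exact lt_trans ih h4.1.1.1
        · exact (h4.1 x).1 ih
  · intro hxy
    by_cases hne : x = y
    · exact .inl hne
    refine .inr ?_
    -- Walk back along `r` from `y`: a first child steps to its parent, where `x` may be met; any
    -- other vertex steps to its previous sibling, which has the same strict ancestors.
    induction hn : ρ y using Nat.strong_induction_on generalizing y with
    | _ n ih =>
      subst hn
      by_cases hL : L y
      · obtain ⟨p, hp, hpm⟩ := h.exists_parent hxy hne
        have hpr : r p y := .inl ⟨⟨hp, fun w hw => hpm w hw.1 hw.2⟩, hL⟩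
        by_cases hxp : x = p
        · subst hxp
          exact ⟨y, hpr, hL, .refl⟩
        · obtain ⟨z, h1, h2, h3⟩ := ih _ (rρ hpr) p (hpm x hxy hne) hxp rfl
          exact ⟨z, h1, h2, h3.tail hpr⟩
      · obtain ⟨p, hp⟩ := hprev y hL
        have hxp : lt x p := (hp.1 x).2 ⟨hxy, hne⟩
        obtain ⟨z, h1, h2, h3⟩ := ih _ hp.2.1 p hxp.1 hxp.2 rfl
        exact ⟨z, h1, h2, h3.tail (.inr hp)⟩

end forest

/-! ### Tree decompositions and forest orders -/

section parentGraph

variable {A : Type}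

/-- The graph joining each vertex to its parent. -/
def parentGraph (q : A → A) : SimpleGraph A where
  Adj x y := x ≠ y ∧ (q x = y ∨ q y = x)
  symm := ⟨fun _ _ h => ⟨h.1.symm, h.2.symm⟩⟩
  loopless := ⟨fun _ h => h.1 rfl⟩

theorem parentGraph_induce_connected (q : A → A) (ρ : A → ℕ) (S : Set A) (t : A) (ht : t ∈ S)
    (hS : ∀ y ∈ S, y ≠ t → q y ∈ S ∧ ρ (q y) < ρ y) : ((parentGraph q).induce S).Connected := by
  have key : ∀ n, ∀ y (hy : y ∈ S), ρ y = n →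
      ((parentGraph q).induce S).Reachable ⟨y, hy⟩ ⟨t, ht⟩ := by
    intro n
    induction n using Nat.strong_induction_on with
    | _ n ih =>
      rintro y hy rfl
      by_cases hyt : y = t
      · subst hyt; exact SimpleGraph.Reachable.refl _
      · obtain ⟨h1, h2⟩ := hS y hy hyt
        refine SimpleGraph.Reachable.trans (SimpleGraph.Adj.reachable ?_) (ih _ h2 (q y) h1 rfl)
        exact ⟨fun he : y = q y => by rw [← he] at h2; exact h2.false, .inl rfl⟩
  have : Nonempty S := ⟨⟨t, ht⟩⟩
  exact ⟨fun x y => (key _ x.1 x.2 rfl).trans (key _ y.1 y.2 rfl).symm⟩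

/-- Every edge is `s(y, q y)` for some `y ≠ root`, so there are fewer edges than vertices; a
connected graph with so few edges is a tree. -/
theorem parentGraph_isTree [Finite A] (q : A → A) (ρ : A → ℕ) (root : A) (hroot : q root = root)
    (hq : ∀ y, y ≠ root → ρ (q y) < ρ y) : (parentGraph q).IsTree := by
  have hconn : (parentGraph q).Connected := by
    have h1 := parentGraph_induce_connected q ρ Set.univ root trivial
      (fun y _ hy => ⟨trivial, hq y hy⟩)
    exact (SimpleGraph.Iso.connected_iff (SimpleGraph.induceUnivIso _)).1 h1
  rw [SimpleGraph.isTree_iff_connected_and_card]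
  refine ⟨hconn, le_antisymm ?_ hconn.card_vert_le_card_edgeSet_add_one⟩
  have hsub : (parentGraph q).edgeSet ⊆ (fun y => s(y, q y)) '' {root}ᶜ := by
    intro e he
    induction e with
    | _ x y =>
      obtain ⟨hne, h1 | h1⟩ := (SimpleGraph.mem_edgeSet _).1 he
      · refine ⟨x, ?_, by simp [h1]⟩
        rintro rfl
        exact hne (hroot.symm.trans h1)
      · refine ⟨y, ?_, by simp [h1, Sym2.eq_swap]⟩
        rintro rfl
        exact hne (h1.symm.trans hroot)
  have h1 := (Set.ncard_le_ncard hsub (Set.toFinite _)).trans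
    (Set.ncard_image_le (Set.toFinite _))
  have h2 := Set.ncard_add_ncard_compl ({root} : Set A)
  rw [Set.ncard_singleton] at h2
  rw [Nat.card_coe_set_eq]
  omega

end parentGraph

/-- A graph whose edges join each vertex to some of its nearest coloured ancestors in a forest
coloured with `k + 1` colours has tree-width at most `k`. -/
theorem IsForestOrder.treeWidthLE {A : Type} [Finite A] [Nonempty A] {le : A → A → Prop}
    (h : IsForestOrder le) (G : SimpleGraph A) (k : ℕ) (C : ℕ → A → Prop)
    (hC : ∀ x, ∃ j < k + 1, C j x)
    (hG : ∀ u v, G.Adj u v → ∃ j < k + 1, Nearest le (C j) u v ∨ Nearest le (C j) v u) :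
    TreeWidthLE G k := by
  classical
  obtain ⟨ρ, hinj, hρ⟩ := h.exists_rank
  obtain ⟨root, -, hroot⟩ := exists_min_rank ρ (fun _ : A => True) ⟨Classical.arbitrary A, trivial⟩
  let par : A → A → Prop := fun p y => (le p y ∧ p ≠ y) ∧ ∀ w, le w y → w ≠ y → le w p
  -- Minimal elements of the forest are sent to `root`, which joins the components into one tree.
  let q : A → A := fun y => if hy : ∃ p, par p y then hy.choose else root
  have hq1 : ∀ x y, le x y → x ≠ y → par (q y) y := by
    intro x y hxy hne
    have hy : ∃ p, par p y := h.exists_parent hxy hne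
    simp only [q, dif_pos hy]
    exact hy.choose_spec
  have hnoroot : ¬ ∃ p, par p root := fun ⟨p, hp, _⟩ =>
    absurd (hρ _ _ hp.1 hp.2) (not_lt.2 (hroot p trivial))
  have hqroot : q root = root := dif_neg hnoroot
  have hq : ∀ y, y ≠ root → ρ (q y) < ρ y := by
    intro y hy
    by_cases h1 : ∃ p, par p y
    · simp only [q, dif_pos h1]
      exact hρ _ _ h1.choose_spec.1.1 h1.choose_spec.1.2
    · simp only [q, dif_neg h1]
      exact lt_of_le_of_ne (hroot y trivial) (fun he => hy (hinj he).symm)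
  -- The default `y` is harmless: `y` is in its own bag anyway, through its own colour.
  let bag : A → Finset A := fun y => (Finset.range (k + 1)).image fun j =>
    if hy : ∃ x, Nearest le (C j) x y then hy.choose else y
  have hbag : ∀ v y, v ∈ bag y ↔ ∃ j < k + 1, Nearest le (C j) v y := by
    intro v y
    simp only [bag, Finset.mem_image, Finset.mem_range]
    constructor
    · rintro ⟨j, hj, rfl⟩
      split_ifs with h1
      · exact ⟨j, hj, h1.choose_spec⟩
      · obtain ⟨i, hi, hCi⟩ := hC y
        exact ⟨i, hi, Nearest.self h hCi⟩
    · rintro ⟨j, hj, hv⟩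
      refine ⟨j, hj, ?_⟩
      have h1 : ∃ x, Nearest le (C j) x y := ⟨v, hv⟩
      rw [dif_pos h1]
      exact Nearest.unique h h1.choose_spec hv
  have hself : ∀ v, v ∈ bag v := fun v => by
    obtain ⟨j, hj, hCj⟩ := hC v
    exact (hbag v v).2 ⟨j, hj, Nearest.self h hCj⟩
  refine ⟨A, inferInstance, parentGraph q, bag, parentGraph_isTree q ρ root hqroot hq,
    fun y => Finset.card_image_le.trans (by simp), fun u v huv => ?_, fun v => ?_⟩
  · obtain ⟨j, hj, h1 | h1⟩ := hG u v huv
    · exact ⟨v, (hbag u v).2 ⟨j, hj, h1⟩, hself v⟩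
    · exact ⟨u, hself u, (hbag v u).2 ⟨j, hj, h1⟩⟩
  -- If `v` is the nearest ancestor of colour `j` of `y ≠ v`, it is also that of the parent of `y`,
  -- so one can climb from `y` to `v` among nodes whose bags contain `v`.
  · refine parentGraph_induce_connected q ρ _ v (hself v) fun y hy hyv => ?_
    obtain ⟨j, hj, hvy⟩ := (hbag v y).1 hy
    have hp := hq1 v y hvy.1 (Ne.symm hyv)
    refine ⟨(hbag v _).2 ⟨j, hj, hp.2 v hvy.1 (Ne.symm hyv), hvy.2.1, fun w h1 h2 h3 =>
      hvy.2.2 w h1 (h.trans h2 hp.1.1) h3⟩, hρ _ _ hp.1.1 hp.1.2⟩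

/-! ### Separation in rooted trees -/

section rooted

variable {I : Type} {T : SimpleGraph I}

/-- `x` lies below `i` when the tree is rooted at `i₀`. -/
def SimpleGraph.Below (T : SimpleGraph I) (i₀ i x : I) : Prop :=
  ∀ p : T.Walk i₀ x, i ∈ p.support

/-- The walk can leave the part below `i` only at `i`: if `x` is below `i` and its neighbour `z` is
not, a walk to `z` avoiding `i`, prolonged by the edge to `x`, shows `x = i`. -/
theorem SimpleGraph.Below.mem_of_walk {i₀ i x y : I} (S : Set I) (hx : T.Below i₀ i x)
    (hy : ¬ T.Below i₀ i y) (p : T.Walk x y) (hp : ∀ z ∈ p.support, z ∈ S) : i ∈ S := by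
  induction p with
  | nil => exact absurd hx hy
  | @cons x z y hxz p ih =>
    by_cases hz : T.Below i₀ i z
    · exact ih hz hy fun w hw => hp w (by simp [hw])
    · simp only [SimpleGraph.Below, not_forall] at hz
      obtain ⟨w, hw⟩ := hz
      have := hx (w.concat hxz.symm)
      simp only [SimpleGraph.Walk.support_concat, List.mem_append, List.mem_singleton] at this
      rcases this with h1 | rfl
      · exact absurd h1 hw
      · exact hp i (by simp)

theorem SimpleGraph.Below.eq_of_dist_le (hT : T.Connected) {i₀ i x : I} (hx : T.Below i₀ i x)
    (hd : T.dist i₀ x ≤ T.dist i₀ i) : x = i := by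
  classical
  obtain ⟨p, hp⟩ := hT.exists_walk_length_eq_dist i₀ x
  have hi := hx p
  have h1 := p.take_spec hi
  have h2 := congrArg SimpleGraph.Walk.length h1
  rw [SimpleGraph.Walk.length_append] at h2
  have h3 := SimpleGraph.dist_le (p.takeUntil i hi)
  exact (SimpleGraph.Walk.eq_of_length_eq_zero (p := p.dropUntil i hi) (by omega)).symm

/-- The vertex `j` is the first step from `i` towards `x`. Going from `i₀` to `x` off `i`, back to
`j` and on to `i` yields, after shortcuts, a path whose last edge is `j`–`i`. Paths in a tree are
unique, so it is a shortest one. -/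
theorem SimpleGraph.IsTree.exists_dist_lt (hT : T.IsTree) {i₀ i x : I} (S : Set I)
    (hx : ¬ T.Below i₀ i x) (p : T.Walk i x) (hp : ∀ z ∈ p.support, z ∈ S) :
    ∃ j ∈ S, T.dist i₀ j < T.dist i₀ i := by
  classical
  simp only [SimpleGraph.Below, not_forall] at hx
  obtain ⟨w, hw⟩ := hx
  have hb := SimpleGraph.Walk.bypass_isPath p
  have hsub := p.support_bypass_subset_support
  generalize p.bypass = b at hb hsub
  cases b with
  | nil => simp at hw
  | @cons _ j _ hij b =>
    rw [SimpleGraph.Walk.cons_isPath_iff] at hb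
    refine ⟨j, hp j (hsub (by simp)), ?_⟩
    have h1 : i ∉ ((w.append b.reverse).bypass).support := fun hm => by
      have := SimpleGraph.Walk.support_bypass_subset_support _ hm
      simp only [SimpleGraph.Walk.mem_support_append_iff, SimpleGraph.Walk.support_reverse,
        List.mem_reverse] at this
      exact this.elim hw hb.2
    have h2 : (((w.append b.reverse).bypass).concat hij.symm).IsPath :=
      (SimpleGraph.Walk.bypass_isPath _).concat h1 _
    obtain ⟨d, hd, hdl⟩ := hT.connected.exists_path_of_dist i₀ i
    have h3 : (⟨_, h2⟩ : T.Path i₀ i) = ⟨_, hd⟩ := (hT.isAcyclic.subsingleton_path _ _).elim _ _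
    have h4 := congrArg (fun q : T.Path i₀ i => q.1.length) h3
    simp only [SimpleGraph.Walk.length_concat] at h4
    have h5 := SimpleGraph.dist_le (w.append b.reverse).bypass
    omega

theorem SimpleGraph.exists_walk_of_induce_connected {S : Set I} (h : (T.induce S).Connected)
    {x y : I} (hx : x ∈ S) (hy : y ∈ S) : ∃ p : T.Walk x y, ∀ z ∈ p.support, z ∈ S := by
  have key : ∀ (a b : S), (T.induce S).Walk a b →
      ∃ p : T.Walk (a : I) b, ∀ z ∈ p.support, z ∈ S := by
    intro a b p
    induction p with
    | nil => exact ⟨.nil, by simp⟩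
    | @cons a b c hab _ ih =>
      obtain ⟨q, hq⟩ := ih
      have hab' : T.Adj (a : I) b := hab
      exact ⟨.cons hab' q, by simpa using hq⟩
  obtain ⟨p⟩ := h.preconnected ⟨x, hx⟩ ⟨y, hy⟩
  exact key _ _ p

/-- If two subtrees of a rooted tree meet, then the top of the one with the lower top lies in the
other one. -/
theorem SimpleGraph.IsTree.top_mem (hT : T.IsTree) {i₀ t i m : I} {S S' : Set I}
    (hS : (T.induce S).Connected) (hS' : (T.induce S').Connected) (ht : t ∈ S) (hi : i ∈ S')
    (hmin : ∀ j ∈ S', T.dist i₀ i ≤ T.dist i₀ j) (hle : T.dist i₀ t ≤ T.dist i₀ i) (hm : m ∈ S)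
    (hm' : m ∈ S') : i ∈ S := by
  -- Otherwise the walk from `i` to `m` inside `S'` would lead to a vertex of `S'` nearer to `i₀`
  -- than its top `i`.
  have h1 : T.Below i₀ i m := by
    by_contra hno
    obtain ⟨p, hp⟩ := exists_walk_of_induce_connected hS' hi hm'
    obtain ⟨j, hj, hlt⟩ := hT.exists_dist_lt S' hno p hp
    exact absurd (hmin j hj) (not_le.2 hlt)
  by_cases h2 : T.Below i₀ i t
  · exact h2.eq_of_dist_le hT.connected hle ▸ ht
  · obtain ⟨p, hp⟩ := exists_walk_of_induce_connected hS hm ht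
    exact h1.mem_of_walk S h2 p hp

end rooted

/-- A graph of tree-width at most `k` has a chordal completion in which every vertex has at most
`k` neighbours of smaller rank. -/
theorem TreeWidthLE.exists_elimination {A : Type} [Finite A] {G : SimpleGraph A} {k : ℕ}
    (h : TreeWidthLE G k) :
    ∃ (ρ : A → ℕ) (D : A → A → Prop), Function.Injective ρ ∧ (∀ u v, D u v → ρ u < ρ v) ∧
      (∀ u v w, D u w → D v w → ρ u < ρ v → D u v) ∧ (∀ v, {u | D u v}.ncard ≤ k) ∧
      ∀ u v, G.Adj u v → D u v ∨ D v u := by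
  classical
  obtain ⟨I, _, T, bag, hT, hcard, hedge, hconn⟩ := h
  obtain ⟨i₀⟩ := hT.connected.nonempty
  have htop : ∀ v, ∃ i, v ∈ bag i ∧ ∀ j, v ∈ bag j → T.dist i₀ i ≤ T.dist i₀ j := by
    intro v
    obtain ⟨⟨i, hi⟩⟩ := (hconn v).nonempty
    exact exists_min_rank (fun i => T.dist i₀ i) (fun i => v ∈ bag i) ⟨i, hi⟩
  choose top htop hmin using htop
  obtain ⟨n, ⟨e⟩⟩ := Finite.exists_equiv_fin A
  -- Depth of the top of the subtree of `v`, with ties broken by an index below `n`.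
  let ρ : A → ℕ := fun v => n * T.dist i₀ (top v) + e v
  have hinj : Function.Injective ρ := fun x y hxy => by
    have h1 := congrArg (· % n) hxy
    simp [ρ, Nat.mod_eq_of_lt (e x).2, Nat.mod_eq_of_lt (e y).2] at h1
    exact e.injective (Fin.ext h1)
  have hρ : ∀ u v, ρ u < ρ v → T.dist i₀ (top u) ≤ T.dist i₀ (top v) := by
    intro u v huv
    by_contra hlt
    have h2 := (e v).2
    have h3 : n * (T.dist i₀ (top v) + 1) ≤ n * T.dist i₀ (top u) :=
      Nat.mul_le_mul_left n (not_le.1 hlt)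
    simp only [Nat.mul_add, Nat.mul_one] at h3
    simp only [ρ] at huv
    omega
  have hshare : ∀ u v i, u ∈ bag i → v ∈ bag i → ρ u < ρ v → u ∈ bag (top v) := by
    intro u v i hu hv huv
    exact hT.top_mem (S := {i | u ∈ bag i}) (S' := {i | v ∈ bag i}) (hconn u) (hconn v) (htop u)
      (htop v) (hmin v) (hρ u v huv) hu hv
  -- Earlier neighbours of `v` share its top bag, which makes the completion chordal; `v` occupies
  -- one of the `k + 1` places there, leaving `k`.
  refine ⟨ρ, fun u v => ρ u < ρ v ∧ u ∈ bag (top v), hinj, fun u v h1 => h1.1,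
    fun u v w h1 h2 h3 => ⟨h3, hshare u v _ h1.2 h2.2 h3⟩, fun v => ?_, fun u v huv => ?_⟩
  · have hsub : {u | ρ u < ρ v ∧ u ∈ bag (top v)} ⊆ ((bag (top v)).erase v : Finset A) := by
      rintro u ⟨h1, h2⟩
      simp only [Finset.coe_erase, Set.mem_sdiff, Finset.mem_coe, Set.mem_singleton_iff]
      exact ⟨h2, fun he => by rw [he] at h1; exact h1.false⟩
    have h1 := Set.ncard_le_ncard hsub (Finset.finite_toSet _)
    rw [Set.ncard_coe_finset, Finset.card_erase_of_mem (htop v)] at h1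
    have h2 := hcard (top v)
    exact h1.trans (by omega)
  · obtain ⟨i, hu, hv⟩ := hedge u v huv
    rcases lt_trichotomy (ρ u) (ρ v) with h1 | h1 | h1
    · exact .inl ⟨h1, hshare u v i hu hv h1⟩
    · exact absurd (hinj h1) huv.ne
    · exact .inr ⟨h1, hshare v u i hv hu h1⟩

/-- Greedy colouring along a ranking. -/
theorem exists_greedy_colouring {A : Type} [Finite A] (ρ : A → ℕ) (hinj : Function.Injective ρ)
    (D : A → A → Prop) (hD : ∀ u v, D u v → ρ u < ρ v) {k : ℕ} (hk : ∀ v, {u | D u v}.ncard ≤ k) :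
    ∃ c : A → ℕ, (∀ v, c v < k + 1) ∧ ∀ u v, D u v → c u ≠ c v := by
  classical
  have key : ∀ n, ∃ c : A → ℕ, (∀ v, c v < k + 1) ∧ ∀ u v, ρ v < n → D u v → c u ≠ c v := by
    intro n
    induction n with
    | zero => exact ⟨fun _ => 0, fun _ => Nat.succ_pos k, fun u v h => absurd h (Nat.not_lt_zero _)⟩
    | succ n ih =>
      obtain ⟨c, hc1, hc2⟩ := ih
      by_cases hv : ∃ v, ρ v = n
      · obtain ⟨v, rfl⟩ := hv
        -- The at most `k` earlier neighbours cannot use up all `k + 1` colours.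
        obtain ⟨j, hj, hj'⟩ : ∃ j ∈ Finset.range (k + 1), j ∉ c '' {u | D u v} := by
          by_contra hno
          push Not at hno
          have h1 := Set.ncard_le_ncard (s := (Finset.range (k + 1) : Set ℕ)) hno (Set.toFinite _)
          rw [Set.ncard_coe_finset, Finset.card_range] at h1
          have h2 := (Set.ncard_image_le (f := c) (Set.toFinite {u | D u v})).trans (hk v)
          omega
        refine ⟨Function.update c v j, fun w => ?_, fun u w hw huw => ?_⟩
        · by_cases hwv : w = v
          · subst hwv; simpa using hj
          · simpa [hwv] using hc1 w
        · have hlt := hD u w huw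
          have huv : u ≠ v := by rintro rfl; omega
          by_cases hwv : w = v
          · subst hwv
            simp only [Function.update_self, Function.update_of_ne huv]
            exact fun he => hj' ⟨u, huw, he⟩
          · simp only [Function.update_of_ne huv, Function.update_of_ne hwv]
            have : ρ w ≠ ρ v := fun he => hwv (hinj he)
            exact hc2 u w (by omega) huw
      · refine ⟨c, hc1, fun u v h1 h2 => hc2 u v ?_ h2⟩
        have : ρ v ≠ n := fun he => hv ⟨v, he⟩
        omega
  obtain ⟨N, hN⟩ := (Set.finite_range ρ).bddAbove
  obtain ⟨c, hc1, hc2⟩ := key (N + 1)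
  exact ⟨c, hc1, fun u v => hc2 u v (Nat.lt_succ_of_le (hN ⟨v, rfl⟩))⟩

/-- A graph of tree-width at most `k` has a forest order and a colouring with `k + 1` colours such
that every edge joins a vertex to its nearest ancestor of some colour. -/
theorem TreeWidthLE.exists_forest {A : Type} [Finite A] {G : SimpleGraph A} {k : ℕ}
    (h : TreeWidthLE G k) :
    ∃ (le : A → A → Prop) (c : A → ℕ), IsForestOrder le ∧ (∀ v, c v < k + 1) ∧
      ∀ u v, G.Adj u v →
        Nearest le (fun x => c x = c u) u v ∨ Nearest le (fun x => c x = c v) v u := by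
  obtain ⟨ρ, D, hinj, hD, hchord, hk, hG⟩ := h.exists_elimination
  obtain ⟨c, hc, hcD⟩ := exists_greedy_colouring ρ hinj D hD hk
  have hle : ∀ {x y}, Relation.ReflTransGen D x y → ρ x ≤ ρ y := by
    intro x y hxy
    induction hxy with
    | refl => exact le_rfl
    | tail _ h1 ih => exact ih.trans (hD _ _ h1).le
  -- Chordality, applied backwards along the chain from `w` to `v`, moves the edge from `u` down to
  -- `w`.
  have hdown : ∀ {u v w}, D u v → Relation.ReflTransGen D w v → ρ u < ρ w → D u w := by
    intro u v w huv hwv hlt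
    induction hwv with
    | refl => exact huv
    | tail h1 h2 ih => exact ih (hchord _ _ _ huv h2 (hlt.trans_le (hle h1)))
  have hchain : ∀ {x y z}, Relation.ReflTransGen D x z → Relation.ReflTransGen D y z →
      Relation.ReflTransGen D x y ∨ Relation.ReflTransGen D y x := by
    intro x y z hx hy
    induction hx with
    | refl => exact .inr hy
    | @tail a z hxa haz ih =>
      rcases lt_trichotomy (ρ a) (ρ y) with h1 | h1 | h1
      · exact .inl (hxa.tail (hdown haz hy h1))
      · exact .inl (hinj h1 ▸ hxa)
      · rcases hy.cases_tail with rfl | ⟨b, hyb, hbz⟩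
        · exact absurd (hD _ _ haz) h1.asymm
        -- It suffices that `y` lies below `a` in the order. The chain from `y` to `z` has an edge
        -- at which the rank reaches or passes that of `a`, and chordality makes its lower end
        -- adjacent to `a` unless its upper end is `a`.
        · refine ih ?_
          clear ih hxa hy
          induction hyb using Relation.ReflTransGen.head_induction_on with
          | refl => exact .single (hchord _ _ _ hbz haz h1)
          | head h2 h3 ih =>
            rename_i d d'
            rcases lt_trichotomy (ρ d') (ρ a) with h4 | h4 | h4
            · exact .head h2 (ih h4)
            · exact .single (hinj h4 ▸ h2)
            · exact .single (hdown h2 (.single (hdown haz (h3.tail hbz) h4)) h1)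
  refine ⟨Relation.ReflTransGen D, c, ⟨fun _ => .refl, fun h1 h2 => h1.trans h2,
    fun h1 h2 => hinj (le_antisymm (hle h1) (hle h2)), hchain⟩, hc, ?_⟩
  -- A vertex of the colour of `u` strictly between `u` and `v` would be adjacent to `u` by `hdown`,
  -- against the proper colouring.
  have hnear : ∀ u v, D u v → Nearest (Relation.ReflTransGen D) (fun x => c x = c u) u v := by
    intro u v huv
    refine ⟨.single huv, rfl, fun w h1 h2 h3 => ?_⟩
    by_contra hne
    have hlt : ρ u < ρ w := lt_of_le_of_ne (hle h1) fun he => hne (hinj he).symm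
    exact hcD u w (hdown huv h2 hlt) h3.symm
  exact fun u v huv => (hG u v huv).imp (hnear u v) (hnear v u)

/-! ### Translating monadic second order formulas to labelled binary trees -/

/-- The relation coded by the out-labels `O` and the in-labels `I` of a coloured forest. -/
def Decode {A : Type} (le : A → A → Prop) (C : ℕ → A → Prop) (K : ℕ) (O I : ℕ → A → Prop)
    (x y : A) : Prop :=
  ∃ j < K, (Nearest le (C j) y x ∧ O j x) ∨ (Nearest le (C j) x y ∧ I j y)

/-- Every subrelation of a coded relation is coded by some labels. -/
theorem Decode.of_subrelation {A : Type} {le : A → A → Prop} (h : IsForestOrder le)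
    {C : ℕ → A → Prop} {K : ℕ} {Q : A → A → Prop}
    (hQ : ∀ x y, Q x y → ∃ j < K, Nearest le (C j) y x ∨ Nearest le (C j) x y) (x y : A) :
    Decode le C K (fun j x => ∃ y, Nearest le (C j) y x ∧ Q x y)
      (fun j y => ∃ x, Nearest le (C j) x y ∧ Q x y) x y ↔ Q x y := by
  constructor
  · rintro ⟨j, -, ⟨h1, z, h2, h3⟩ | ⟨h1, z, h2, h3⟩⟩
    · rwa [h1.unique h h2]
    · rwa [h1.unique h h2]
  · intro hxy
    obtain ⟨j, hj, h1 | h1⟩ := hQ x y hxy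
    · exact ⟨j, hj, .inl ⟨h1, y, h1, hxy⟩⟩
    · exact ⟨j, hj, .inr ⟨h1, x, h1, hxy⟩⟩

/-- Numbers of the set variables used by the translation: tag `0` for the set variables of the
given formula, `1` and `2` for out-labels and in-labels, `3` for colours, `4` for the set of left
children, `5` for an auxiliary variable. -/
def setVar (t a b : ℕ) : ℕ := Nat.pair t (Nat.pair a b)

@[simp]
theorem setVar_inj {t a b t' a' b' : ℕ} :
    setVar t a b = setVar t' a' b' ↔ t = t' ∧ a = a' ∧ b = b' := by
  simp [setVar, Nat.pair_eq_pair]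

theorem setVar_mono {t a b t' a' b' : ℕ} (ht : t ≤ t') (ha : a ≤ a') (hb : b ≤ b') :
    setVar t a b ≤ setVar t' a' b' := by
  have mono : ∀ {a b c d : ℕ}, a ≤ c → b ≤ d → Nat.pair a b ≤ Nat.pair c d := by
    intro a b c d h1 h2
    have h3 : Nat.pair a b ≤ Nat.pair c b := by
      rcases h1.lt_or_eq with h | h
      · exact (Nat.pair_lt_pair_left b h).le
      · rw [h]
    have h4 : Nat.pair c b ≤ Nat.pair c d := by
      rcases h2.lt_or_eq with h | h
      · exact (Nat.pair_lt_pair_right c h).le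
      · rw [h]
    exact h3.trans h4
  exact mono ht (mono ha hb)

namespace MSO

section formulas

variable {s : ℕ} {W : Finset ℕ}

def or {C : Vocab} (φ ψ : MSO C) : MSO C := neg (and (neg φ) (neg ψ))

/-- `y` is a child of `x`. -/
def edge (x y : ℕ) : MSO (treeVocab s W) := binary ⟨s, Finset.mem_singleton_self s⟩ x y

/-- `y` is reachable from `z`. -/
def reachF (z y : ℕ) : MSO (treeVocab s W) :=
  neg (exSet (setVar 5 0 0) (and (memSet (setVar 5 0 0) z) (and
    (neg (exElem 0 (exElem 1 (and (memSet (setVar 5 0 0) 0)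
      (and (edge 0 1) (neg (memSet (setVar 5 0 0) 1)))))))
    (neg (memSet (setVar 5 0 0) y)))))

/-- Bound element variables are reserved by nesting: `0` and `1` in `reachF`, `2` here, `3` in
`nearestF`, `4` and `5` in `coverF` and `subrelF`. Variables of the given formula are shifted by
`6`, so nothing is captured; this explains the lower bounds on variables in the semantic lemmas. -/
def ancestorF (x y : ℕ) : MSO (treeVocab s W) :=
  or (eq x y) (exElem 2 (and (edge x 2) (and (memSet (setVar 4 0 0) 2) (reachF 2 y))))

def nearestF (j x y : ℕ) : MSO (treeVocab s W) :=
  and (ancestorF x y) (and (memSet (setVar 3 0 j) x)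
    (neg (exElem 3 (and (ancestorF x 3) (and (ancestorF 3 y)
      (and (memSet (setVar 3 0 j) 3) (neg (eq 3 x))))))))

def decodeF (i x y : ℕ) : ℕ → MSO (treeVocab s W)
  | 0 => neg (eq x x)
  | j + 1 => or (decodeF i x y j)
      (or (and (nearestF j y x) (memSet (setVar 1 i j) x))
        (and (nearestF j x y) (memSet (setVar 2 i j) y)))

def colouredF : ℕ → MSO (treeVocab s W)
  | 0 => neg (eq 4 4)
  | j + 1 => or (colouredF j) (memSet (setVar 3 0 j) 4)

def coverF (K : ℕ) : MSO (treeVocab s W) := neg (exElem 4 (neg (colouredF K)))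

def subrelF (K i i' : ℕ) : MSO (treeVocab s W) :=
  neg (exElem 4 (exElem 5 (and (decodeF i 4 5 K) (neg (decodeF i' 4 5 K)))))

def exSets {C : Vocab} (l : List ℕ) (φ : MSO C) : MSO C := l.foldr exSet φ

/-- The variables for the labels that code the relation number `i`. -/
def labelVars (K i : ℕ) : List ℕ :=
  (List.range K).flatMap fun j => [setVar 1 i j, setVar 2 i j]

theorem mem_labelVars {K i v : ℕ} :
    v ∈ labelVars K i ↔ ∃ j < K, v = setVar 1 i j ∨ v = setVar 2 i j := by
  simp [labelVars]

/-- The translation. The labels of the relation variable `P` have number `2 * P`, those of the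
relation symbol `B` have number `2 * B + 1`. -/
def translate (K s : ℕ) {C : Vocab} : MSO C → MSO (treeVocab s C.un)
  | eq x y => eq (x + 6) (y + 6)
  | unary U x => unary ⟨U.1, U.2⟩ (x + 6)
  | binary B x y => decodeF (2 * B.1 + 1) (x + 6) (y + 6) K
  | memSet X x => memSet (setVar 0 X 0) (x + 6)
  | memRel P x y => decodeF (2 * P) (x + 6) (y + 6) K
  | neg φ => neg (translate K s φ)
  | and φ ψ => and (translate K s φ) (translate K s ψ)
  | exElem x φ => exElem (x + 6) (translate K s φ)
  | exSet X φ => exSet (setVar 0 X 0) (translate K s φ)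
  | exRel P B φ => exSets (labelVars K (2 * P))
      (and (subrelF K (2 * P) (2 * B.1 + 1)) (translate K s φ))

/-- A bound on the set variables occurring in the translation of a formula with code at most
`m`. -/
def varBound (K m : ℕ) : ℕ := setVar 5 (2 * m + 1) K + 1

/-- The sentence saying that there are a colouring and labels coding a model of `φ`. -/
def treeSentence (K s : ℕ) {C : Vocab} (φ : MSO C) : MSO (treeVocab s C.un) :=
  exSets (List.range (varBound K φ.code)) (and (coverF K) (translate K s φ))

end formulas

/-! ### Meaning of the auxiliary formulas -/

section semantics

variable {s : ℕ} {W : Finset ℕ} {A : Type} (T : Struc (treeVocab s W) A)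
  (e : ℕ → A) (S : ℕ → A → Prop) (R : ℕ → A → A → Prop)

@[simp]
theorem sat_or {C : Vocab} (M : Struc C A) (φ ψ : MSO C) :
    Sat M (or φ ψ) e S R ↔ Sat M φ e S R ∨ Sat M ψ e S R := by
  simp only [or, Sat]; tauto

@[simp]
theorem sat_edge (x y : ℕ) :
    Sat T (edge x y) e S R ↔ T.treeRel (e x) (e y) := Iff.rfl

/-- The formula says that every set containing `z` and closed under children contains `y`; the set
of vertices reachable from `z` is the least such set. -/
theorem sat_reachF {z y : ℕ} (hz : 2 ≤ z) (hy : 2 ≤ y) :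
    Sat T (reachF z y) e S R ↔ Relation.ReflTransGen T.treeRel (e z) (e y) := by
  have hz0 : z ≠ 0 := by omega
  have hz1 : z ≠ 1 := by omega
  have hy0 : y ≠ 0 := by omega
  have hy1 : y ≠ 1 := by omega
  simp only [reachF, Sat, sat_edge, Function.update_self, ne_eq, zero_ne_one, not_false_eq_true,
    Function.update_of_ne, not_exists, not_and, not_not]
  constructor
  · intro h
    exact h (fun a => Relation.ReflTransGen T.treeRel (e z) a) .refl
      fun a b h1 h2 => h1.tail h2
  · intro h Y h1 h2
    generalize e y = b at h
    induction h with
    | refl => exact h1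
    | tail _ h3 ih => exact h2 _ _ ih h3

theorem sat_ancestorF {x y : ℕ} (hx : 3 ≤ x) (hy : 3 ≤ y) :
    Sat T (ancestorF x y) e S R ↔ Ancestor T.treeRel (S (setVar 4 0 0)) (e x) (e y) := by
  have hx2 : x ≠ 2 := by omega
  have hy2 : y ≠ 2 := by omega
  simp [ancestorF, Sat, sat_reachF T _ S R le_rfl (show 2 ≤ y by omega), hx2, hy2, Ancestor]

theorem sat_nearestF {x y : ℕ} (j : ℕ) (hx : 4 ≤ x) (hy : 4 ≤ y) :
    Sat T (nearestF j x y) e S R ↔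
      Nearest (Ancestor T.treeRel (S (setVar 4 0 0))) (S (setVar 3 0 j)) (e x) (e y) := by
  have hx3 : x ≠ 3 := by omega
  have hy3 : y ≠ 3 := by omega
  simp [nearestF, Sat, sat_ancestorF T _ S R (show 3 ≤ x by omega) (show 3 ≤ y by omega),
    sat_ancestorF T _ S R (show 3 ≤ x by omega) le_rfl,
    sat_ancestorF T _ S R le_rfl (show 3 ≤ y by omega), hx3, hy3, Nearest]

/-- The relation with number `i` that the set variables code. -/
def decoded (K i : ℕ) (r : A → A → Prop) (S : ℕ → A → Prop) : A → A → Prop :=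
  Decode (Ancestor r (S (setVar 4 0 0))) (fun j => S (setVar 3 0 j)) K
    (fun j => S (setVar 1 i j)) (fun j => S (setVar 2 i j))

theorem sat_decodeF {x y : ℕ} (i K : ℕ) (hx : 4 ≤ x) (hy : 4 ≤ y) :
    Sat T (decodeF i x y K) e S R ↔ decoded K i T.treeRel S (e x) (e y) := by
  simp only [decoded, Decode]
  induction K with
  | zero => simp [decodeF, Sat]
  | succ K ih =>
    simp only [decodeF, sat_or, ih, Sat, sat_nearestF T e S R _ hx hy,
      sat_nearestF T e S R _ hy hx, Nat.lt_succ_iff_lt_or_eq]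
    constructor
    · rintro (⟨j, hj, h⟩ | h)
      · exact ⟨j, .inl hj, h⟩
      · exact ⟨K, .inr rfl, h⟩
    · rintro ⟨j, hj | rfl, h⟩
      · exact .inl ⟨j, hj, h⟩
      · exact .inr h

theorem sat_colouredF (K : ℕ) :
    Sat T (colouredF K) e S R ↔ ∃ j < K, S (setVar 3 0 j) (e 4) := by
  induction K with
  | zero => simp [colouredF, Sat]
  | succ K ih =>
    simp only [colouredF, sat_or, ih, Sat, Nat.lt_succ_iff_lt_or_eq]
    constructor
    · rintro (⟨j, hj, h⟩ | h)
      · exact ⟨j, .inl hj, h⟩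
      · exact ⟨K, .inr rfl, h⟩
    · rintro ⟨j, hj | rfl, h⟩
      · exact .inl ⟨j, hj, h⟩
      · exact .inr h

theorem sat_coverF (K : ℕ) :
    Sat T (coverF K) e S R ↔ ∀ x, ∃ j < K, S (setVar 3 0 j) x := by
  simp [coverF, Sat, sat_colouredF]

theorem sat_subrelF (K i i' : ℕ) :
    Sat T (subrelF K i i') e S R ↔
      ∀ x y, decoded K i T.treeRel S x y → decoded K i' T.treeRel S x y := by
  simp [subrelF, Sat, sat_decodeF]

theorem sat_exSets {C : Vocab} (M : Struc C A) (l : List ℕ) (φ : MSO C) :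
    Sat M (exSets l φ) e S R ↔ ∃ S', (∀ i, i ∉ l → S' i = S i) ∧ Sat M φ e S' R := by
  induction l generalizing S with
  | nil =>
    simp only [exSets, List.foldr_nil, List.not_mem_nil, not_false_eq_true, forall_const]
    exact ⟨fun h => ⟨S, fun _ => rfl, h⟩, fun ⟨S', h1, h2⟩ => (funext h1 : S' = S) ▸ h2⟩
  | cons a l ih =>
    change (∃ Y, Sat M (exSets l φ) e (Function.update S a Y) R) ↔ _
    simp only [ih, List.mem_cons, not_or]
    constructor
    · rintro ⟨Y, S', h1, h2⟩
      exact ⟨S', fun i hi => (h1 i hi.2).trans (Function.update_of_ne hi.1 _ _), h2⟩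
    · rintro ⟨S', h1, h2⟩
      refine ⟨S' a, S', fun i hi => ?_, h2⟩
      by_cases hia : i = a
      · subst hia; simp
      · rw [Function.update_of_ne hia, h1 i ⟨hia, hi⟩]

theorem decoded_congr {K i : ℕ} {r : A → A → Prop} {S S' : ℕ → A → Prop}
    (h1 : ∀ j, S' (setVar 1 i j) = S (setVar 1 i j))
    (h2 : ∀ j, S' (setVar 2 i j) = S (setVar 2 i j))
    (h3 : ∀ j, S' (setVar 3 0 j) = S (setVar 3 0 j))
    (h4 : S' (setVar 4 0 0) = S (setVar 4 0 0)) :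
    decoded K i r S' = decoded K i r S := by
  simp only [decoded, h1, h2, h3, h4]

theorem decoded_update {K i X : ℕ} {r : A → A → Prop} {S : ℕ → A → Prop} {Y : A → Prop} :
    decoded K i r (Function.update S (setVar 0 X 0) Y) = decoded K i r S := by
  apply decoded_congr <;> intros <;> apply Function.update_of_ne <;> simp

end semantics

theorem sat_congr {C : Vocab} {A : Type} (M : Struc C A) (φ : MSO C) {e e' : ℕ → A}
    {S S' : ℕ → A → Prop} {R R' : ℕ → A → A → Prop}
    (he : ∀ x, .elem x ∈ φ.free → e x = e' x) (hS : ∀ X, .set X ∈ φ.free → S X = S' X)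
    (hR : ∀ P, .rel P ∈ φ.free → R P = R' P) : Sat M φ e S R ↔ Sat M φ e' S' R' := by
  induction φ generalizing e e' S S' R R' with
  | eq x y => simp only [Sat, he x (by simp [free]), he y (by simp [free])]
  | unary U x => simp only [Sat, he x (by simp [free])]
  | binary B x y => simp only [Sat, he x (by simp [free]), he y (by simp [free])]
  | memSet X x => simp only [Sat, he x (by simp [free]), hS X (by simp [free])]
  | memRel P x y =>
    simp only [Sat, he x (by simp [free]), he y (by simp [free]), hR P (by simp [free])]
  | neg φ ih => simp only [Sat, ih he hS hR]
  | and φ ψ ih1 ih2 =>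
    simp only [Sat, free, Set.mem_union] at *
    rw [ih1 (fun x h => he x (.inl h)) (fun x h => hS x (.inl h)) (fun x h => hR x (.inl h)),
      ih2 (fun x h => he x (.inr h)) (fun x h => hS x (.inr h)) (fun x h => hR x (.inr h))]
  | exElem x φ ih =>
    simp only [Sat, free] at *
    refine exists_congr fun a => ih (fun y hy => ?_) (fun X h => hS X (by simp [h]))
      (fun P h => hR P (by simp [h]))
    by_cases hyx : y = x
    · subst hyx; simp
    · simp [hyx, he y (by simp [hy, hyx])]
  | exSet X φ ih =>
    simp only [Sat, free] at *
    refine exists_congr fun a => ih (fun x h => he x (by simp [h])) (fun Y hY => ?_)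
      (fun P h => hR P (by simp [h]))
    by_cases hYX : Y = X
    · subst hYX; simp
    · simp [hYX, hS Y (by simp [hY, hYX])]
  | exRel P B φ ih =>
    simp only [Sat, free] at *
    refine exists_congr fun a => and_congr_right fun _ =>
      ih (fun x h => he x (by simp [h])) (fun X h => hS X (by simp [h])) (fun Q hQ => ?_)
    by_cases hQP : Q = P
    · subst hQP; simp
    · simp [hQP, hR Q (by simp [hQ, hQP])]

theorem IsSentence.models_of_sat {C : Vocab} {A : Type} {M : Struc C A} {φ : MSO C}
    (hφ : φ.IsSentence) {e : ℕ → A} {S : ℕ → A → Prop} {R : ℕ → A → A → Prop}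
    (h : Sat M φ e S R) : φ.Models M := by
  intro e' S' R'
  have h0 : ∀ v, v ∉ φ.free := fun v => by rw [hφ]; exact Set.notMem_empty v
  exact (sat_congr M φ (fun x hx => absurd hx (h0 _)) (fun x hx => absurd hx (h0 _))
    (fun x hx => absurd hx (h0 _))).1 h

/-- The translation is correct for structures whose relations are coded by the set variables. -/
theorem sat_translate {K s : ℕ} {C : Vocab} {A : Type} {T : Struc (treeVocab s C.un) A}
    (hT : IsBinaryTree T.treeRel) {M : Struc C A}
    (hun : ∀ (U : C.un) x, M.un U x ↔ T.un ⟨U.1, U.2⟩ x) {m : ℕ} (φ : MSO C) (hφ : φ.code ≤ m)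
    (e : ℕ → A) (S : ℕ → A → Prop) (R : ℕ → A → A → Prop)
    (hbin : ∀ B : C.bin, B.1 ≤ m → M.bin B = decoded K (2 * B.1 + 1) T.treeRel S) :
    Sat T (translate K s φ) e S R ↔ Sat M φ (fun x => e (x + 6)) (fun X => S (setVar 0 X 0))
      (fun P => decoded K (2 * P) T.treeRel S) := by
  induction φ generalizing e S R with
  | eq x y => exact Iff.rfl
  | unary U x => exact (hun U _).symm
  | binary B x y =>
    have hB : B.1 ≤ m :=
      (Nat.left_le_pair _ _).trans ((Nat.right_le_pair _ _).trans hφ)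
    rw [translate, sat_decodeF T e S R _ _ (by omega) (by omega)]
    simp only [Sat, hbin B hB]
  | memSet X x => exact Iff.rfl
  | memRel P x y =>
    rw [translate, sat_decodeF T e S R _ _ (by omega) (by omega)]
    simp only [Sat]
  | neg φ ih =>
    simp only [translate, Sat, ih ((Nat.right_le_pair _ _).trans hφ) e S R hbin]
  | and φ ψ ih1 ih2 =>
    have h1 : φ.code ≤ m := (Nat.left_le_pair _ _).trans ((Nat.right_le_pair _ _).trans hφ)
    have h2 : ψ.code ≤ m := (Nat.right_le_pair _ _).trans ((Nat.right_le_pair _ _).trans hφ)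
    simp only [translate, Sat, ih1 h1 e S R hbin, ih2 h2 e S R hbin]
  | exElem x φ ih =>
    have h1 : φ.code ≤ m := (Nat.right_le_pair _ _).trans ((Nat.right_le_pair _ _).trans hφ)
    simp only [translate, Sat]
    refine exists_congr fun a => ?_
    rw [ih h1 _ S R hbin]
    have : (fun y => Function.update e (x + 6) a (y + 6)) =
        Function.update (fun y => e (y + 6)) x a := by
      funext y
      by_cases hy : y = x <;> simp [hy]
    rw [this]
  | exSet X φ ih =>
    have h1 : φ.code ≤ m := (Nat.right_le_pair _ _).trans ((Nat.right_le_pair _ _).trans hφ)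
    simp only [translate, Sat]
    refine exists_congr fun Y => ?_
    rw [ih h1 _ _ R fun B hB => (hbin B hB).trans decoded_update.symm]
    have : (fun Z => Function.update S (setVar 0 X 0) Y (setVar 0 Z 0)) =
        Function.update (fun Z => S (setVar 0 Z 0)) X Y := by
      funext Z
      by_cases hZ : Z = X <;> simp [hZ]
    simp only [this, decoded_update]
  | exRel P B φ ih =>
    have h1 : φ.code ≤ m :=
      (Nat.right_le_pair _ _).trans ((Nat.right_le_pair _ _).trans ((Nat.right_le_pair _ _).trans hφ))
    have hB : B.1 ≤ m :=
      (Nat.left_le_pair _ _).trans ((Nat.right_le_pair _ _).trans ((Nat.right_le_pair _ _).trans hφ))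
    -- Requantifying the labels of `P` leaves everything else fixed: relation symbols have odd label
    -- numbers, relation variables even ones, and colours and left children have other tags.
    have hne : ∀ {t a b}, (t ≠ 1 ∧ t ≠ 2) ∨ a ≠ 2 * P → setVar t a b ∉ labelVars K (2 * P) := by
      intro t a b h hmem
      obtain ⟨j, -, h2 | h2⟩ := mem_labelVars.1 hmem <;> simp at h2 <;> omega
    have hdec : ∀ {S' : ℕ → A → Prop} {i}, (∀ v, v ∉ labelVars K (2 * P) → S' v = S v) →
        i ≠ 2 * P → decoded K i T.treeRel S' = decoded K i T.treeRel S := by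
      intro S' i hS' hi
      apply decoded_congr <;> intros <;> apply hS' <;> apply hne <;> simp [hi]
    have hcongr : ∀ {S' : ℕ → A → Prop}, (∀ v, v ∉ labelVars K (2 * P) → S' v = S v) →
        (Sat T (translate K s φ) e S' R ↔ Sat M φ (fun x => e (x + 6))
          (fun X => S (setVar 0 X 0)) (Function.update (fun Q => decoded K (2 * Q) T.treeRel S) P
            (decoded K (2 * P) T.treeRel S'))) := by
      intro S' hS'
      rw [ih h1 e S' R fun B hB => (hbin B hB).trans (hdec hS' (by omega)).symm]
      have e1 : (fun X => S' (setVar 0 X 0)) = fun X => S (setVar 0 X 0) :=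
        funext fun X => hS' _ (hne (by simp))
      have e2 : (fun Q => decoded K (2 * Q) T.treeRel S') =
          Function.update (fun Q => decoded K (2 * Q) T.treeRel S) P
            (decoded K (2 * P) T.treeRel S') := by
        funext Q
        by_cases hQ : Q = P
        · subst hQ; simp
        · rw [Function.update_of_ne hQ]; exact hdec hS' (by omega)
      rw [e1, e2]
    simp only [translate, sat_exSets, Sat, sat_subrelF]
    constructor
    · rintro ⟨S', hS', h2, h3⟩
      refine ⟨decoded K (2 * P) T.treeRel S', fun a b hab => ?_, (hcongr hS').1 h3⟩
      rw [hbin B hB, ← hdec hS' (by omega)]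
      exact h2 a b hab
    · rintro ⟨Q, hQ, h3⟩
      classical
      let near : ℕ → A → A → Prop := fun j =>
        Nearest (Ancestor T.treeRel (S (setVar 4 0 0))) (S (setVar 3 0 j))
      -- The labels of `P` are read off from `Q` as in `Decode.of_subrelation`, tag `1` giving
      -- out-labels and tag `2` in-labels.
      let S' : ℕ → A → Prop := fun v =>
        if v ∈ labelVars K (2 * P) then
          if v.unpair.1 = 1 then fun x => ∃ y, near v.unpair.2.unpair.2 y x ∧ Q x y
          else fun y => ∃ x, near v.unpair.2.unpair.2 x y ∧ Q x y
        else S v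
      have hS' : ∀ v, v ∉ labelVars K (2 * P) → S' v = S v := fun v hv => if_neg hv
      have hmem : ∀ {j}, j < K → setVar 1 (2 * P) j ∈ labelVars K (2 * P) ∧
          setVar 2 (2 * P) j ∈ labelVars K (2 * P) := fun {j} hj =>
        ⟨mem_labelVars.2 ⟨j, hj, .inl rfl⟩, mem_labelVars.2 ⟨j, hj, .inr rfl⟩⟩
      have hQS : decoded K (2 * P) T.treeRel S' = Q := by
        funext x y
        apply propext
        rw [← Decode.of_subrelation (hT.isForestOrder_ancestor (S (setVar 4 0 0)))
          (C := fun j => S (setVar 3 0 j)) (K := K) (Q := Q) ?_ x y]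
        · simp only [decoded, Decode]
          rw [hS' (setVar 4 0 0) (hne (by simp))]
          refine exists_congr fun j => and_congr_right fun hj => ?_
          rw [hS' (setVar 3 0 j) (hne (by simp))]
          simp only [S', (hmem hj).1, (hmem hj).2, if_true]
          simp [setVar, near]
        -- `Q` lies inside the interpretation of `B`, which is itself decoded, so its pairs run
        -- along nearest-ancestor edges.
        · intro a b hab
          have h4 := hQ a b hab
          rw [hbin B hB] at h4
          obtain ⟨j, hj, h5⟩ := h4
          exact ⟨j, hj, h5.imp And.left And.left⟩
      refine ⟨S', hS', fun x y hxy => ?_, (hcongr hS').2 (hQS ▸ h3)⟩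
      rw [hdec hS' (by omega), ← hbin B hB]
      exact hQ x y (hQS ▸ hxy)

end MSO

namespace MSO

/-! ### Free variables of the translation -/

section free

variable {s : ℕ} {W : Finset ℕ}

theorem free_reachF (z y : ℕ) :
    (reachF z y : MSO (treeVocab s W)).free ⊆ {.elem z, .elem y} := by
  intro v
  simp only [reachF, edge, free, Set.mem_sdiff, Set.mem_union, Set.mem_insert_iff,
    Set.mem_singleton_iff]
  tauto

theorem free_ancestorF (x y : ℕ) :
    (ancestorF x y : MSO (treeVocab s W)).free ⊆ {.elem x, .elem y, .set (setVar 4 0 0)} := by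
  intro v
  have := @free_reachF s W 2 y v
  simp only [ancestorF, or, edge, free, Set.mem_sdiff, Set.mem_union, Set.mem_insert_iff,
    Set.mem_singleton_iff] at *
  tauto

theorem free_nearestF (j x y : ℕ) : (nearestF j x y : MSO (treeVocab s W)).free ⊆
    {.elem x, .elem y, .set (setVar 4 0 0), .set (setVar 3 0 j)} := by
  intro v
  have h1 := @free_ancestorF s W x y v
  have h2 := @free_ancestorF s W x 3 v
  have h3 := @free_ancestorF s W 3 y v
  simp only [nearestF, free, Set.mem_sdiff, Set.mem_union, Set.mem_insert_iff,
    Set.mem_singleton_iff] at *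
  tauto

/-- The variables below the bound for codes at most `m`. -/
def boundedVars (K m : ℕ) : Set MSOVar := {v | ∃ i < varBound K m, v = .set i}

theorem setVar_mem_boundedVars {K m t a b : ℕ} (ht : t ≤ 5) (ha : a ≤ 2 * m + 1) (hb : b ≤ K) :
    .set (setVar t a b) ∈ boundedVars K m :=
  ⟨_, Nat.lt_succ_of_le (setVar_mono ht ha hb), rfl⟩

theorem free_decodeF {K m i : ℕ} (x y : ℕ) (hi : i ≤ 2 * m + 1) {j : ℕ} (hj : j ≤ K) :
    (decodeF i x y j : MSO (treeVocab s W)).free ⊆ {.elem x, .elem y} ∪ boundedVars K m := by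
  induction j with
  | zero => intro v; simp [decodeF, free]; tauto
  | succ j ih =>
    intro v
    have h0 := @ih (by omega) v
    have h1 := @free_nearestF s W j x y v
    have h2 := @free_nearestF s W j y x v
    have h3 := setVar_mem_boundedVars (K := K) (m := m) (t := 4) (a := 0) (b := 0) (by omega)
      (by omega) (by omega)
    have h4 := setVar_mem_boundedVars (K := K) (m := m) (t := 3) (a := 0) (b := j) (by omega)
      (by omega) (by omega)
    have h5 := setVar_mem_boundedVars (K := K) (m := m) (t := 1) (a := i) (b := j) (by omega)
      hi (by omega)
    have h6 := setVar_mem_boundedVars (K := K) (m := m) (t := 2) (a := i) (b := j) (by omega)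
      hi (by omega)
    simp only [decodeF, or, free, Set.mem_union, Set.mem_insert_iff,
      Set.mem_singleton_iff] at h0 h1 h2 ⊢
    rintro (h | (h | h) | (h | h))
    · exact h0 h
    · rcases h2 h with rfl | rfl | rfl | rfl <;>
        first | exact .inl (.inl rfl) | exact .inl (.inr rfl) | exact .inr (by assumption)
    · rcases h with rfl | rfl <;>
        first | exact .inl (.inl rfl) | exact .inl (.inr rfl) | exact .inr (by assumption)
    · rcases h1 h with rfl | rfl | rfl | rfl <;>
        first | exact .inl (.inl rfl) | exact .inl (.inr rfl) | exact .inr (by assumption)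
    · rcases h with rfl | rfl <;>
        first | exact .inl (.inl rfl) | exact .inl (.inr rfl) | exact .inr (by assumption)

theorem free_colouredF {K m j : ℕ} (hj : j ≤ K) :
    (colouredF j : MSO (treeVocab s W)).free ⊆ {.elem 4} ∪ boundedVars K m := by
  induction j with
  | zero => intro v; simp [colouredF, free]; tauto
  | succ j ih =>
    intro v
    have h0 := @ih (by omega) v
    have h4 := setVar_mem_boundedVars (K := K) (m := m) (t := 3) (a := 0) (b := j) (by omega)
      (by omega) (by omega)
    simp only [colouredF, or, free, Set.mem_union, Set.mem_insert_iff,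
      Set.mem_singleton_iff] at h0 ⊢
    rintro (h | (rfl | rfl))
    · exact h0 h
    · exact .inr h4
    · exact .inl rfl

theorem free_coverF (K m : ℕ) :
    (coverF K : MSO (treeVocab s W)).free ⊆ boundedVars K m := by
  intro v hv
  have h0 := @free_colouredF s W K m K le_rfl v
  simp only [coverF, free, Set.mem_sdiff, Set.mem_union, Set.mem_singleton_iff] at hv h0
  tauto

theorem free_subrelF {K m i i' : ℕ} (hi : i ≤ 2 * m + 1) (hi' : i' ≤ 2 * m + 1) :
    (subrelF K i i' : MSO (treeVocab s W)).free ⊆ boundedVars K m := by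
  intro v hv
  have h0 := @free_decodeF s W K m i 4 5 hi K le_rfl v
  have h1 := @free_decodeF s W K m i' 4 5 hi' K le_rfl v
  simp only [subrelF, free, Set.mem_sdiff, Set.mem_union, Set.mem_insert_iff,
    Set.mem_singleton_iff] at hv h0 h1
  tauto

theorem free_exSets {C : Vocab} (l : List ℕ) (φ : MSO C) :
    (exSets l φ).free = φ.free \ {v | ∃ i ∈ l, v = .set i} := by
  induction l with
  | nil => simp [exSets]
  | cons a l ih =>
    change (exSets l φ).free \ {.set a} = _
    rw [ih]
    ext v
    simp only [Set.mem_sdiff, Set.mem_ofPred_eq, Set.mem_singleton_iff, List.mem_cons]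
    constructor
    · rintro ⟨⟨h1, h2⟩, h3⟩
      refine ⟨h1, ?_⟩
      rintro ⟨i, rfl | hi, rfl⟩
      · exact h3 rfl
      · exact h2 ⟨i, hi, rfl⟩
    · rintro ⟨h1, h2⟩
      exact ⟨⟨h1, fun ⟨i, hi, hv⟩ => h2 ⟨i, .inr hi, hv⟩⟩, fun hv => h2 ⟨a, .inl rfl, hv⟩⟩

/-- Indices in a formula are bounded by its code, so the code controls every set variable that the
final block of quantifiers must bind. Relation variables disappear altogether. -/
theorem free_translate {K m s : ℕ} {C : Vocab} (φ : MSO C) (hφ : φ.code ≤ m) :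
    (translate K s φ).free ⊆
      {v | ∃ x, v = .elem (x + 6) ∧ .elem x ∈ φ.free} ∪ boundedVars K m := by
  induction φ with
  | eq x y =>
    rintro v (rfl | rfl)
    · exact .inl ⟨x, rfl, .inl rfl⟩
    · exact .inl ⟨y, rfl, .inr rfl⟩
  | unary U x =>
    rintro v rfl
    exact .inl ⟨x, rfl, rfl⟩
  | binary B x y =>
    have hB : B.1 ≤ m := (Nat.left_le_pair _ _).trans ((Nat.right_le_pair _ _).trans hφ)
    intro v hv
    rcases free_decodeF (m := m) (x + 6) (y + 6) (by omega) le_rfl hv with (rfl | rfl) | h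
    · exact .inl ⟨x, rfl, .inl rfl⟩
    · exact .inl ⟨y, rfl, .inr rfl⟩
    · exact .inr h
  | memSet X x =>
    have hX : X ≤ m := (Nat.left_le_pair _ _).trans ((Nat.right_le_pair _ _).trans hφ)
    rintro v (rfl | rfl)
    · exact .inr (setVar_mem_boundedVars (by omega) (by omega) (by omega))
    · exact .inl ⟨x, rfl, .inr rfl⟩
  | memRel P x y =>
    have hP : P ≤ m := (Nat.left_le_pair _ _).trans ((Nat.right_le_pair _ _).trans hφ)
    intro v hv
    rcases free_decodeF (m := m) (x + 6) (y + 6) (by omega) le_rfl hv with (rfl | rfl) | h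
    · exact .inl ⟨x, rfl, .inr (.inl rfl)⟩
    · exact .inl ⟨y, rfl, .inr (.inr rfl)⟩
    · exact .inr h
  | neg φ ih => exact ih ((Nat.right_le_pair _ _).trans hφ)
  | and φ ψ ih1 ih2 =>
    have h1 : φ.code ≤ m := (Nat.left_le_pair _ _).trans ((Nat.right_le_pair _ _).trans hφ)
    have h2 : ψ.code ≤ m := (Nat.right_le_pair _ _).trans ((Nat.right_le_pair _ _).trans hφ)
    rintro v (hv | hv)
    · exact (ih1 h1 hv).imp (fun ⟨x, h3, h4⟩ => ⟨x, h3, .inl h4⟩) id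
    · exact (ih2 h2 hv).imp (fun ⟨x, h3, h4⟩ => ⟨x, h3, .inr h4⟩) id
  | exElem x φ ih =>
    have h1 : φ.code ≤ m := (Nat.right_le_pair _ _).trans ((Nat.right_le_pair _ _).trans hφ)
    rintro v ⟨hv, hvx⟩
    refine (ih h1 hv).imp (fun ⟨y, h3, h4⟩ => ⟨y, h3, h4, fun he => hvx ?_⟩) id
    cases he
    exact h3
  | exSet X φ ih =>
    have h1 : φ.code ≤ m := (Nat.right_le_pair _ _).trans ((Nat.right_le_pair _ _).trans hφ)
    rintro v ⟨hv, -⟩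
    exact (ih h1 hv).imp (fun ⟨y, h3, h4⟩ => ⟨y, h3, h4, nofun⟩) id
  | exRel P B φ ih =>
    have h0 := (Nat.right_le_pair _ _).trans hφ
    have h1 : φ.code ≤ m := (Nat.right_le_pair _ _).trans ((Nat.right_le_pair _ _).trans h0)
    have hP : P ≤ m := (Nat.left_le_pair _ _).trans h0
    have hB : B.1 ≤ m := (Nat.left_le_pair _ _).trans ((Nat.right_le_pair _ _).trans h0)
    intro v hv
    rw [translate, free_exSets] at hv
    rcases hv.1 with h | h
    · exact .inr (free_subrelF (by omega) (by omega) h)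
    · exact (ih h1 h).imp (fun ⟨y, h3, h4⟩ => ⟨y, h3, h4, nofun⟩) id

theorem IsSentence.treeSentence {K s : ℕ} {C : Vocab} {φ : MSO C} (hφ : φ.IsSentence) :
    (treeSentence K s φ).IsSentence := by
  rw [IsSentence, MSO.treeSentence, free_exSets, Set.eq_empty_iff_forall_notMem]
  rintro v ⟨hv, hno⟩
  have hb : v ∈ boundedVars K φ.code := by
    rcases hv with h | h
    · exact free_coverF K _ h
    · rcases free_translate φ le_rfl h with ⟨x, -, hx⟩ | h
      · rw [hφ] at hx; exact absurd hx (Set.notMem_empty _)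
      · exact h
  obtain ⟨i, hi, rfl⟩ := hb
  exact hno ⟨i, List.mem_range.2 hi, rfl⟩

end free

/-! ### Computability of the translation -/

section effective

/-- Functions computing the codes of the auxiliary formulas. -/
def decodeCode (s i x y K : ℕ) : ℕ := (decodeF i x y K : MSO (treeVocab s ∅)).code

def subrelCode (K s i i' : ℕ) : ℕ := (subrelF K i i' : MSO (treeVocab s ∅)).code

def exSetsCode (l : List ℕ) (c : ℕ) : ℕ := l.foldr (fun i c => Nat.pair 8 (Nat.pair i c)) c

theorem code_exSets {C : Vocab} (l : List ℕ) (φ : MSO C) :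
    (exSets l φ).code = exSetsCode l φ.code := by
  induction l with
  | nil => rfl
  | cons a l ih => exact congrArg (fun c => Nat.pair 8 (Nat.pair a c)) ih

variable {s : ℕ} {W : Finset ℕ}

/-- No unary symbol of the vocabulary occurs, so the code does not depend on `W` and can be computed
from numbers alone, over the empty set. -/
theorem code_decodeF (i x y K : ℕ) :
    (decodeF i x y K : MSO (treeVocab s W)).code = decodeCode s i x y K := by
  unfold decodeCode
  induction K with
  | zero => rfl
  | succ K ih =>
    simp only [decodeF, or, code, ih]
    rfl

theorem code_subrelF (K i i' : ℕ) :
    (subrelF K i i' : MSO (treeVocab s W)).code = subrelCode K s i i' := by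
  simp only [subrelCode, subrelF, code, code_decodeF]

theorem code_coverF (K : ℕ) : (coverF K : MSO (treeVocab s W)).code =
    (coverF K : MSO (treeVocab 0 ∅)).code := by
  simp only [coverF, code]
  congr 4
  induction K with
  | zero => rfl
  | succ K ih => simp only [colouredF, or, code, ih]

/-- One step of the computation of the code of a translation, given a table of the translations of
smaller codes. -/
def translateStep (K s n : ℕ) (t : List ℕ) : ℕ :=
  let c := n.unpair.2
  let a := c.unpair.1
  let b := c.unpair.2
  if n.unpair.1 = 0 then Nat.pair 0 (Nat.pair (a + 6) (b + 6))
  else if n.unpair.1 = 1 then Nat.pair 1 (Nat.pair a (b + 6))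
  else if n.unpair.1 = 2 then decodeCode s (2 * a + 1) (b.unpair.1 + 6) (b.unpair.2 + 6) K
  else if n.unpair.1 = 3 then Nat.pair 3 (Nat.pair (setVar 0 a 0) (b + 6))
  else if n.unpair.1 = 4 then decodeCode s (2 * a) (b.unpair.1 + 6) (b.unpair.2 + 6) K
  else if n.unpair.1 = 5 then Nat.pair 5 (t.getD c 0)
  else if n.unpair.1 = 6 then Nat.pair 6 (Nat.pair (t.getD a 0) (t.getD b 0))
  else if n.unpair.1 = 7 then Nat.pair 7 (Nat.pair (a + 6) (t.getD b 0))
  else if n.unpair.1 = 8 then Nat.pair 8 (Nat.pair (setVar 0 a 0) (t.getD b 0))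
  else exSetsCode (labelVars K (2 * a)) (Nat.pair 6 (Nat.pair
    (subrelCode K s (2 * a) (2 * b.unpair.1 + 1)) (t.getD b.unpair.2 0)))

/-- Course-of-values recursion: the list of values at all numbers below `n`. Values at numbers that
code no formula are irrelevant. -/
def translateTable (K s : ℕ) : ℕ → List ℕ
  | 0 => []
  | n + 1 => translateTable K s n ++ [translateStep K s n (translateTable K s n)]

def translateCode (K s n : ℕ) : ℕ := translateStep K s n (translateTable K s n)

theorem length_translateTable (K s n : ℕ) : (translateTable K s n).length = n := by
  induction n with
  | zero => rfl
  | succ n ih => simp [translateTable, ih]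

theorem translateTable_getD (K s : ℕ) {i n : ℕ} (h : i < n) :
    (translateTable K s n).getD i 0 = translateCode K s i := by
  induction n with
  | zero => omega
  | succ n ih =>
    rcases Nat.lt_succ_iff_lt_or_eq.1 h with h1 | rfl
    · rw [← ih h1, translateTable, List.getD_append _ _ _ _ (by rwa [length_translateTable])]
    · rw [translateTable, List.getD_append_right _ _ _ _ (by rw [length_translateTable]),
        length_translateTable]
      simp [translateCode]

/-- A nonzero tag makes codes of subformulas strictly smaller, hence found in the table; `Nat.pair 0
0 = 0` shows that tag zero would not do. -/
theorem lt_pair_succ (t c : ℕ) : c < Nat.pair (t + 1) c :=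
  (Nat.right_le_pair 0 c).trans_lt (Nat.pair_lt_pair_left c (Nat.succ_pos t))

theorem translateCode_code (K s : ℕ) {C : Vocab} (φ : MSO C) :
    translateCode K s φ.code = (translate K s φ).code := by
  induction φ with
  | eq x y => simp [translateCode, translateStep, translate, code]
  | unary U x => simp [translateCode, translateStep, translate, code]
  | binary B x y => simp [translateCode, translateStep, translate, code, code_decodeF]
  | memSet X x => simp [translateCode, translateStep, translate, code]
  | memRel P x y => simp [translateCode, translateStep, translate, code, code_decodeF]
  | neg φ ih =>
    rw [translate, code, code, ← ih, ← translateTable_getD K s (lt_pair_succ 4 φ.code)]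
    simp [translateCode, translateStep]
  | and φ ψ ih1 ih2 =>
    rw [translate, code, code, ← ih1, ← ih2,
      ← translateTable_getD K s ((Nat.left_le_pair φ.code ψ.code).trans_lt (lt_pair_succ 5 _)),
      ← translateTable_getD K s ((Nat.right_le_pair φ.code ψ.code).trans_lt (lt_pair_succ 5 _))]
    simp [translateCode, translateStep]
  | exElem x φ ih =>
    rw [translate, code, code, ← ih,
      ← translateTable_getD K s ((Nat.right_le_pair x φ.code).trans_lt (lt_pair_succ 6 _))]
    simp [translateCode, translateStep]
  | exSet X φ ih =>
    rw [translate, code, code, ← ih,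
      ← translateTable_getD K s ((Nat.right_le_pair X φ.code).trans_lt (lt_pair_succ 7 _))]
    simp [translateCode, translateStep]
  | exRel P B φ ih =>
    rw [translate, code, code_exSets, code, code_subrelF, ← ih,
      ← translateTable_getD K s (((Nat.right_le_pair B.1 φ.code).trans
        (Nat.right_le_pair P _)).trans_lt (lt_pair_succ 8 _))]
    simp [translateCode, translateStep]

def treeSentenceCode (K s n : ℕ) : ℕ :=
  exSetsCode (List.range (varBound K n))
    (Nat.pair 6 (Nat.pair (coverF K : MSO (treeVocab 0 ∅)).code (translateCode K s n)))

theorem code_treeSentence (K s : ℕ) {C : Vocab} (φ : MSO C) :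
    (treeSentence K s φ).code = treeSentenceCode K s φ.code := by
  rw [treeSentence, code_exSets, code, code_coverF, ← translateCode_code, treeSentenceCode]

section primrec

variable {α : Type} [Primcodable α] {f g h i : α → ℕ}

theorem primrec_pair (hf : Primrec f) (hg : Primrec g) :
    Primrec fun a => Nat.pair (f a) (g a) := Primrec₂.natPair.comp hf hg

theorem primrec_setVar (hf : Primrec f) (hg : Primrec g) (hh : Primrec h) :
    Primrec fun a => setVar (f a) (g a) (h a) := primrec_pair hf (primrec_pair hg hh)

theorem primrec_reachF (hs : Primrec i) (hf : Primrec f) (hg : Primrec g) :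
    Primrec fun a => (reachF (f a) (g a) : MSO (treeVocab (i a) ∅)).code := by
  simp only [reachF, edge, code]
  repeat' first
      | with_reducible assumption | with_reducible exact Primrec.const _
      | with_reducible apply primrec_pair

theorem primrec_ancestorF (hs : Primrec i) (hf : Primrec f) (hg : Primrec g) :
    Primrec fun a => (ancestorF (f a) (g a) : MSO (treeVocab (i a) ∅)).code := by
  simp only [ancestorF, or, edge, code]
  repeat' first
      | with_reducible assumption | with_reducible exact Primrec.const _
      | with_reducible apply primrec_pair
      | with_reducible apply primrec_reachF

theorem primrec_nearestF (j : ℕ) (hs : Primrec i) (hf : Primrec f) (hg : Primrec g) :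
    Primrec fun a => (nearestF j (f a) (g a) : MSO (treeVocab (i a) ∅)).code := by
  simp only [nearestF, code]
  repeat' first
      | with_reducible assumption | with_reducible exact Primrec.const _
      | with_reducible apply primrec_pair
      | with_reducible apply primrec_ancestorF

theorem primrec_decodeCode (K : ℕ) (hs : Primrec i) (hh : Primrec h) (hf : Primrec f)
    (hg : Primrec g) : Primrec fun a => decodeCode (i a) (h a) (f a) (g a) K := by
  unfold decodeCode
  induction K with
  | zero =>
    simp only [decodeF, code]
    repeat' first
      | with_reducible assumption | with_reducible exact Primrec.const _
      | with_reducible apply primrec_pair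
  | succ K ih =>
    simp only [decodeF, or, code]
    repeat' first
      | with_reducible assumption | with_reducible exact Primrec.const _
      | with_reducible apply primrec_pair
      | with_reducible apply primrec_nearestF
      | with_reducible apply primrec_setVar

theorem primrec_subrelCode (K : ℕ) (hs : Primrec i) (hf : Primrec f) (hg : Primrec g) :
    Primrec fun a => subrelCode K (i a) (f a) (g a) := by
  simp only [subrelCode, subrelF, code, code_decodeF]
  repeat' first
      | with_reducible assumption | with_reducible exact Primrec.const _
      | with_reducible apply primrec_pair
      | with_reducible apply primrec_decodeCode

theorem primrec_labelVars (K : ℕ) (hf : Primrec f) : Primrec fun a => labelVars K (f a) := by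
  refine Primrec.list_flatMap (Primrec.const _) (Primrec₂.mk ?_)
  refine Primrec.list_cons.comp ?_ (Primrec.list_cons.comp ?_ (Primrec.const []))
  all_goals exact primrec_setVar (Primrec.const _) (hf.comp Primrec.fst) Primrec.snd

theorem primrec_exSetsCode {l : α → List ℕ} (hl : Primrec l) (hf : Primrec f) :
    Primrec fun a => exSetsCode (l a) (f a) := by
  refine Primrec.list_foldr (h := fun _ p => Nat.pair 8 (Nat.pair p.1 p.2)) hl hf (Primrec₂.mk ?_)
  exact primrec_pair (Primrec.const _) (primrec_pair (Primrec.fst.comp Primrec.snd)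
    (Primrec.snd.comp Primrec.snd))

theorem primrec_affine (m n : ℕ) (hf : Primrec f) : Primrec fun a => m * f a + n :=
  Primrec.nat_add.comp (Primrec.nat_mul.comp (Primrec.const m) hf) (Primrec.const n)

theorem primrec_translateStep (K : ℕ) {t : α → List ℕ} (hs : Primrec i) (hf : Primrec f)
    (ht : Primrec t) : Primrec fun a => translateStep K (i a) (f a) (t a) := by
  have fst : ∀ {f : α → ℕ}, Primrec f → Primrec fun a => (f a).unpair.1 :=
    fun h => Primrec.fst.comp (Primrec.unpair.comp h)
  have snd : ∀ {f : α → ℕ}, Primrec f → Primrec fun a => (f a).unpair.2 :=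
    fun h => Primrec.snd.comp (Primrec.unpair.comp h)
  have getD : ∀ {f : α → ℕ}, Primrec f → Primrec fun a => (t a).getD (f a) 0 :=
    fun h => (Primrec.list_getD 0).comp ht h
  have add : ∀ {f : α → ℕ} (n : ℕ), Primrec f → Primrec fun a => f a + n :=
    fun n h => Primrec.nat_add.comp h (Primrec.const n)
  have mul : ∀ {f : α → ℕ} (n : ℕ), Primrec f → Primrec fun a => n * f a :=
    fun n h => Primrec.nat_mul.comp (Primrec.const n) h
  have eq : ∀ {f : α → ℕ} (n : ℕ), Primrec f → PrimrecPred fun a => f a = n :=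
    fun n h => Primrec.eq.comp h (Primrec.const n)
  have hc := snd hf
  have ha := fst hc
  have hb := snd hc
  simp only [translateStep]
  repeat' first
      | with_reducible assumption | with_reducible exact Primrec.const _
      | with_reducible apply Primrec.ite
      | with_reducible apply eq
      | with_reducible apply primrec_pair
      | with_reducible apply primrec_decodeCode
      | with_reducible apply primrec_setVar
      | with_reducible apply primrec_exSetsCode
      | with_reducible apply primrec_labelVars
      | with_reducible apply primrec_subrelCode
      | with_reducible apply getD
      | with_reducible apply add
      | with_reducible apply mul
      | with_reducible apply fst
      | with_reducible apply snd

theorem primrec_translateCode (K : ℕ) (hs : Primrec i) (hf : Primrec f) :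
    Primrec fun a => translateCode K (i a) (f a) := by
  refine primrec_translateStep K hs hf ?_
  have h1 := Primrec.nat_rec' (α := α) (β := List ℕ) (f := f) (g := fun _ => [])
    (h := fun a p => p.2 ++ [translateStep K (i a) p.1 p.2]) hf (Primrec.const [])
    (Primrec₂.mk (Primrec.list_concat.comp (Primrec.snd.comp Primrec.snd)
      (primrec_translateStep K (hs.comp Primrec.fst) (Primrec.fst.comp Primrec.snd)
        (Primrec.snd.comp Primrec.snd))))
  refine h1.of_eq fun a => ?_
  induction f a with
  | zero => rfl
  | succ n ih => simp only [translateTable, ← ih]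

theorem primrec_treeSentenceCode (K : ℕ) (hs : Primrec i) (hf : Primrec f) :
    Primrec fun a => treeSentenceCode K (i a) (f a) := by
  refine primrec_exSetsCode (Primrec.list_range.comp ?_)
    (primrec_pair (Primrec.const _) (primrec_pair (Primrec.const _) (primrec_translateCode K hs hf)))
  exact Primrec.succ.comp (primrec_setVar (Primrec.const _) (primrec_affine 2 1 hf)
    (Primrec.const _))

end primrec

end effective

end MSO

/-! ### Two-variable formulas over a larger vocabulary -/

namespace C2

variable {C D : Vocab} {A : Type}

/-- The same formula over a larger vocabulary. -/
def lift (h : C ⊆ D) : C2 C → C2 D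
  | eq x y => eq x y
  | unary U x => unary ⟨U.1, h.1 U.2⟩ x
  | binary B x y => binary ⟨B.1, h.2 B.2⟩ x y
  | neg φ => neg (lift h φ)
  | and φ ψ => and (lift h φ) (lift h ψ)
  | ex x φ => ex x (lift h φ)
  | exLE n x φ => exLE n x (lift h φ)
  | exGE n x φ => exGE n x (lift h φ)
  | exEQ n x φ => exEQ n x (lift h φ)

theorem code_lift (h : C ⊆ D) (φ : C2 C) : (lift h φ).code = φ.code := by
  induction φ <;> simp_all [lift, code]

theorem free_lift (h : C ⊆ D) (φ : C2 C) : (lift h φ).free = φ.free := by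
  induction φ <;> simp_all [lift, free]

theorem sat_lift (h : C ⊆ D) (M : Struc D A) (φ : C2 C) (e : Fin 2 → A) :
    Sat M (lift h φ) e ↔ Sat (M.reduct h) φ e := by
  induction φ generalizing e <;> simp_all [lift, Sat, Struc.reduct]

theorem models_lift (h : C ⊆ D) (M : Struc D A) (φ : C2 C) :
    (lift h φ).Models M ↔ φ.Models (M.reduct h) :=
  forall_congr' fun e => sat_lift h M φ e

end C2

/-! ### Passing between structures and labelled trees -/

section encoding

variable {A : Type} {Cbd Cunbd : Vocab} {s : ℕ}

/-- A structure whose bounded part has tree-width at most `k` is coded by a labelled binary tree on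
the same universe. -/
theorem exists_tree_of_treeWidthLE [Finite A] [Nonempty A] {k : ℕ} (hs : s ∉ Cunbd.bin)
    {α : MSO Cbd} (M : Struc (Cbd ∪ Cunbd) A)
    (hα : α.Models (M.reduct (Cbd.subset_union_left Cunbd)))
    (htw : TreeWidthLE (M.reduct (Cbd.subset_union_left Cunbd)).gaifman k) :
    ∃ N : Struc (treeVocab s Cbd.un ∪ Cunbd) A,
      (MSO.treeSentence (k + 1) s α).Models
        (N.reduct ((treeVocab s Cbd.un).subset_union_left Cunbd)) ∧
      N.reduct ((treeVocab s Cbd.un).subset_union_right Cunbd) =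
        M.reduct (Cbd.subset_union_right Cunbd) ∧
      IsBinaryTree (N.reduct ((treeVocab s Cbd.un).subset_union_left Cunbd)).treeRel := by
  classical
  obtain ⟨le, c, hle, hc, hadj⟩ := htw.exists_forest
  obtain ⟨r, L, hr, hrL⟩ := hle.exists_binaryTree
  obtain rfl : Ancestor r L = le := by
    funext x y; exact propext (hrL x y)
  let N : Struc (treeVocab s Cbd.un ∪ Cunbd) A :=
    { un := fun U => M.un ⟨U.1, U.2⟩
      bin := fun B => if h : B.1 ∈ Cunbd.bin then
        M.bin ⟨B.1, (Cbd.subset_union_right Cunbd).2 h⟩ else r }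
  let T := N.reduct ((treeVocab s Cbd.un).subset_union_left Cunbd)
  have hT : T.treeRel = r := dif_neg hs
  have hTtree : IsBinaryTree T.treeRel := hT ▸ hr
  refine ⟨N, ?_, ?_, hTtree⟩
  · intro e S R
    let near : ℕ → A → A → Prop := fun j => Nearest (Ancestor r L) (fun x => c x = j)
    -- The label number `2 * B + 1` of a symbol `B` is decoded by halving.
    let rel : ℕ → A → A → Prop := fun i x y =>
      ∃ h : i / 2 ∈ Cbd.bin, (M.reduct (Cbd.subset_union_left Cunbd)).bin ⟨i / 2, h⟩ x y
    let label : ℕ → ℕ → ℕ → A → Prop := fun t i j x =>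
      (t = 1 ∧ ∃ y, near j y x ∧ rel i x y) ∨ (t = 2 ∧ ∃ y, near j y x ∧ rel i y x) ∨
        (t = 3 ∧ c x = j) ∨ (t = 4 ∧ L x)
    let m := α.code
    let S' : ℕ → A → Prop := fun v =>
      if v < MSO.varBound (k + 1) m then
        label v.unpair.1 v.unpair.2.unpair.1 v.unpair.2.unpair.2
      else S v
    have hlabel : ∀ {t a b}, t ≤ 5 → a ≤ 2 * m + 1 → b ≤ k + 1 →
        S' (setVar t a b) = label t a b := by
      intro t a b ht ha hb
      have h1 : setVar t a b < MSO.varBound (k + 1) m :=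
        Nat.lt_succ_of_le (setVar_mono ht ha hb)
      simp only [S', if_pos h1]
      simp [setVar]
    have hL : S' (setVar 4 0 0) = L := by
      rw [hlabel (by omega) (by omega) (by omega)]
      simp [label]
    have hC : ∀ {j}, j < k + 1 → S' (setVar 3 0 j) = fun x => c x = j := fun {j} hj => by
      rw [hlabel (by omega) (by omega) (by omega)]
      simp [label]
    have hbin : ∀ B : Cbd.bin, B.1 ≤ m → (M.reduct (Cbd.subset_union_left Cunbd)).bin B =
        MSO.decoded (k + 1) (2 * B.1 + 1) T.treeRel S' := by
      intro B hB
      have hrel : rel (2 * B.1 + 1) = (M.reduct (Cbd.subset_union_left Cunbd)).bin B := by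
        have h1 : (2 * B.1 + 1) / 2 = B.1 := by omega
        funext x y
        simp only [rel, h1]
        simp [B.2]
      rw [← hrel]
      funext x y
      apply propext
      rw [← Decode.of_subrelation hle (C := fun j x => c x = j) (K := k + 1)
        (Q := rel (2 * B.1 + 1)) ?_ x y]
      · simp only [MSO.decoded, Decode, hL, hT]
        refine exists_congr fun j => and_congr_right fun hj => ?_
        rw [hC hj, hlabel (t := 1) (by omega) (by omega) (by omega),
          hlabel (t := 2) (by omega) (by omega) (by omega)]
        simp [label, near]
      · intro a b hab
        -- Loops are invisible in the Gaifman graph; they are coded by the vertex itself, its own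
        -- nearest ancestor of its colour.
        by_cases hne : a = b
        · subst hne
          exact ⟨c a, hc a, .inl (Nearest.self hle rfl)⟩
        · rw [hrel] at hab
          rcases hadj a b ⟨hne, B, .inl hab⟩ with h1 | h1
          · exact ⟨c a, hc a, .inr h1⟩
          · exact ⟨c b, hc b, .inl h1⟩
    refine (MSO.sat_exSets e S R T _ _).2 ⟨S', fun i hi => if_neg (by simpa using hi), ?_, ?_⟩
    · rw [MSO.sat_coverF]
      exact fun x => ⟨c x, hc x, by rw [hC (hc x)]⟩
    · exact (MSO.sat_translate hTtree (fun _ _ => Iff.rfl) α le_rfl e S' R hbin).2 (hα _ _ _)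
  · have hbin : ∀ B : Cunbd.bin,
        (N.reduct ((treeVocab s Cbd.un).subset_union_right Cunbd)).bin B =
          (M.reduct (Cbd.subset_union_right Cunbd)).bin B := fun B => dif_pos B.2
    exact congrArg (Struc.mk _) (funext hbin)

/-- A labelled binary tree codes a structure on the same universe whose bounded part has tree-width
at most `k`. -/
theorem exists_treeWidthLE_of_tree [Finite A] [Nonempty A] {k : ℕ}
    (hdisj : Disjoint Cbd.bin Cunbd.bin) {α : MSO Cbd} (hα : α.IsSentence)
    (N : Struc (treeVocab s Cbd.un ∪ Cunbd) A)
    (hN : (MSO.treeSentence (k + 1) s α).Models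
      (N.reduct ((treeVocab s Cbd.un).subset_union_left Cunbd)))
    (hT : IsBinaryTree (N.reduct ((treeVocab s Cbd.un).subset_union_left Cunbd)).treeRel) :
    ∃ M : Struc (Cbd ∪ Cunbd) A,
      α.Models (M.reduct (Cbd.subset_union_left Cunbd)) ∧
      M.reduct (Cbd.subset_union_right Cunbd) =
        N.reduct ((treeVocab s Cbd.un).subset_union_right Cunbd) ∧
      TreeWidthLE (M.reduct (Cbd.subset_union_left Cunbd)).gaifman k := by
  classical
  set T := N.reduct ((treeVocab s Cbd.un).subset_union_left Cunbd)
  obtain ⟨S, -, hcover, hsat⟩ := (MSO.sat_exSets _ _ _ T _ _).1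
    (hN (fun _ => Classical.arbitrary A) (fun _ _ => True) (fun _ _ _ => True))
  rw [MSO.sat_coverF] at hcover
  let M : Struc (Cbd ∪ Cunbd) A :=
    { un := fun U => N.un ⟨U.1, U.2⟩
      bin := fun B => if h : B.1 ∈ Cunbd.bin then
        N.bin ⟨B.1, ((treeVocab s Cbd.un).subset_union_right Cunbd).2 h⟩
        else MSO.decoded (k + 1) (2 * B.1 + 1) T.treeRel S }
  have hbin : ∀ B : Cbd.bin, (M.reduct (Cbd.subset_union_left Cunbd)).bin B =
      MSO.decoded (k + 1) (2 * B.1 + 1) T.treeRel S :=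
    -- Since no binary symbol is shared, decoding the bounded relations leaves the unbounded ones
    -- untouched.
    fun B => dif_neg (Finset.disjoint_left.1 hdisj B.2)
  refine ⟨M, ?_, ?_, ?_⟩
  · exact hα.models_of_sat
      ((MSO.sat_translate hT (fun _ _ => Iff.rfl) α le_rfl _ S _ fun B _ => hbin B).1 hsat)
  · have hbin' : ∀ B : Cunbd.bin, (M.reduct (Cbd.subset_union_right Cunbd)).bin B =
        (N.reduct ((treeVocab s Cbd.un).subset_union_right Cunbd)).bin B := fun B => dif_pos B.2
    exact congrArg (Struc.mk _) (funext hbin')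
  · refine (hT.isForestOrder_ancestor (S (setVar 4 0 0))).treeWidthLE _ k
      (fun j => S (setVar 3 0 j)) hcover ?_
    rintro u v ⟨-, B, h1 | h1⟩ <;> rw [hbin] at h1 <;> obtain ⟨j, hj, h2⟩ := h1
    · exact ⟨j, hj, h2.symm.imp And.left And.left⟩
    · exact ⟨j, hj, h2.imp And.left And.left⟩

end encoding

theorem mainTheorem5 (k : ℕ) :
    ∃ F G : ℕ × ℕ × ℕ × ℕ → ℕ, Computable F ∧ Computable G ∧
      ∀ (Cbd Cunbd : Vocab) (s : ℕ), Disjoint Cbd.bin Cunbd.bin → s ∉ Cunbd.bin →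
        ∃ W : Finset ℕ,
          ∀ (α : MSO Cbd) (β : C2 Cunbd), α.IsSentence → β.IsSentence →
            ∃ (α' : MSO (treeVocab s W)) (β' : C2 (treeVocab s W ∪ Cunbd)),
              α'.IsSentence ∧ β'.IsSentence ∧
              F (Cbd.code, Cunbd.code, s, α.code) = α'.code ∧
              G (Cbd.code, Cunbd.code, s, β.code) = β'.code ∧
              ((∃ (A : Type) (_ : Finite A) (_ : Nonempty A) (M : Struc (Cbd ∪ Cunbd) A),
                  α.Models (M.reduct (Cbd.subset_union_left Cunbd)) ∧
                  β.Models (M.reduct (Cbd.subset_union_right Cunbd)) ∧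
                  TreeWidthLE (M.reduct (Cbd.subset_union_left Cunbd)).gaifman k) ↔
                (∃ (B : Type) (_ : Finite B) (_ : Nonempty B)
                    (N : Struc (treeVocab s W ∪ Cunbd) B),
                  α'.Models (N.reduct ((treeVocab s W).subset_union_left Cunbd)) ∧
                  β'.Models N ∧
                  IsBinaryTree (N.reduct ((treeVocab s W).subset_union_left Cunbd)).treeRel)) := by
  refine ⟨fun x => MSO.treeSentenceCode (k + 1) x.2.2.1 x.2.2.2, fun x => x.2.2.2,
    (MSO.primrec_treeSentenceCode (k + 1)
      (Primrec.fst.comp (Primrec.snd.comp Primrec.snd))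
      (Primrec.snd.comp (Primrec.snd.comp Primrec.snd))).to_comp,
    (Primrec.snd.comp (Primrec.snd.comp Primrec.snd)).to_comp, ?_⟩
  intro Cbd Cunbd s hdisj hs
  -- Colours and labels are quantified inside `α'`, so the added vocabulary needs only the unary
  -- symbols already present and is independent of `k` and of both sentences.
  refine ⟨Cbd.un, fun α β hα hβ => ⟨MSO.treeSentence (k + 1) s α,
    C2.lift ((treeVocab s Cbd.un).subset_union_right Cunbd) β, hα.treeSentence,
    (C2.free_lift _ β).trans hβ, (MSO.code_treeSentence _ _ α).symm, (C2.code_lift _ β).symm,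
    ?_, ?_⟩⟩
  · rintro ⟨A, _, _, M, h1, h2, h3⟩
    obtain ⟨N, h4, h5, h6⟩ := exists_tree_of_treeWidthLE hs M h1 h3
    exact ⟨A, inferInstance, inferInstance, N, h4, (C2.models_lift _ N β).2 (h5 ▸ h2), h6⟩
  · rintro ⟨A, _, _, N, h1, h2, h3⟩
    obtain ⟨M, h4, h5, h6⟩ := exists_treeWidthLE_of_tree hdisj hα N h1 h3
    exact ⟨A, inferInstance, inferInstance, M, h4, h5 ▸ (C2.models_lift _ N β).1 h2, h6⟩
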